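/- Let $M\ge 1$ and $m\ge 0$ be integers such that $\gcd(M,2m+2)=1$ if $m>0$. Let $\tau,z_1,z_2,t\in\mathbb C$ with $\operatorname{Im}\tau>0$, $q^s:=e^{2\pi i s\tau}$. Definitions. For $k\ge 1$ and $j\in\mathbb Z$ put $\Theta_{j,k}(\tau,z)=\sum_{n\in\mathbb Z+j/(2k)}q^{kn^2}e^{2\pi i knz}$ and, with $E(x)=2\int_0^x e^{-\pi u^2}du$, $$R_{k;j}(\tau,v)=\sum_{n\equiv j\ (2k)}\Big(\operatorname{sign}(n+\tfrac12)-E\big((n+2k\tfrac{\operatorname{Im}v}{\operatorname{Im}\tau})(\tfrac{\operatorname{Im}\tau}{k})^{1/2}\big)\Big)e^{-\frac{\pi i n^2}{2k}\tau-2\pi i nv}.$$ Let $$\Phi^{[m]}(\tau,z_1,z_2,t)=e^{2\pi i(m+1)t}\sum_{j\in\mathbb Z}\Big(\frac{e^{2\pi i j(m+1)(z_1+z_2)}q^{j^2(m+1)}}{1-e^{2\pi i z_1}q^j}-\frac{e^{-2\pi i j(m+1)(z_1+z_2)}q^{j^2(m+1)}}{1-e^{-2\pi i z_2}q^j}\Big),$$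 $$\tilde\Phi^{[m]}(\tau,z_1,z_2,t)=\Phi^{[m]}(\tau,z_1,z_2,t)-\tfrac12e^{2\pi i(m+1)t}\sum_{j\in\mathbb Z/(2m+2)\mathbb Z}R_{m+1;j}\big(\tau,\tfrac{z_1-z_2}2\big)\,(\Theta_{j,m+1}-\Theta_{-j,m+1})(\tau,z_1+z_2).$$ For $\epsilon,\epsilon'\in\{0,\tfrac12\}$ and $j,k\in\epsilon'+\mathbb Z$ let $$\tilde\Psi^{[M,m;\epsilon]}_{j,k;\epsilon'}(\tau,z_1,z_2,t)=q^{\frac{(m+1)jk}M}e^{\frac{2\pi i(m+1)}M(kz_1+jz_2)}\,\tilde\Phi^{[m]}\big(M\tau,z_1+j\tau+\epsilon,z_2+k\tau+\epsilon,\tfrac tM\big).$$ The affine superdenominator of $\widehat{s\ell}_{2|1}$ is $$\hat R^{(0)}_0(\tau,z_1,z_2,t)=e^{2\pi it}\prod_{n\ge1}\frac{(1-q^n)^2(1-e^{2\pi i(z_1+z_2)}q^{n-1})(1-e^{-2\pi i(z_1+z_2)}q^n)}{\prod_{i=1,2}(1-e^{2\pi iz_i}q^{n-1})(1-e^{-2\pi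 iz_i}q^n)},$$ and the denominator and the twisted (Ramond) versions are given by $$\hat R^{(\epsilon)}_{\epsilon'}(\tau,z_1,z_2,t)=\hat R^{(0)}_0\big(\tau,\,z_1+\epsilon'\tau+\epsilon,\,z_2+\epsilon'\tau+\epsilon,\,t+\epsilon'(z_1+z_2)+\epsilon'^2\tau\big).$$ For $j,k\in\epsilon'+\mathbb Z$, $0\le j,k<M$, the modified normalized characters ($\epsilon=\tfrac12$) and supercharacters ($\epsilon=0$), untwisted for $\epsilon'=0$ and twisted for $\epsilon'=\tfrac12$, of the principal admissible $\widehat{s\ell}_{2|1}$-modules of level $\frac{m+1}M-1$ are $$\widetilde{\rm ch}^{[M,m;\epsilon]}_{j,k;\epsilon'}=\tilde\Psi^{[M,m;\epsilon]}_{j,k;\epsilon'}\big/\hat R^{(\epsilon)}_{\epsilon'}.$$ Theorem 7.3. Let $\epsilon,\epsilon'\in\{0,\tfrac12\}$ and $j,k\in\epsilon'+\mathbb Z$, $0\le j,k<M$. Off the singularities (for (1): $z_1,z_2\notin\epsilon'+\epsilon\tau+\mathbb Z+\mathbb Z\tau$; for (2): $z_1,z_2\notin\epsilon+\epsilon'+\epsilon'\tau+\mathbb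 Z+\mathbb Z\tau$; in both: $z_1+z_2\notin\mathbb Z+\mathbb Z\tau$) one has $$(1)\quad \widetilde{\rm ch}^{[M,m;\epsilon]}_{j,k;\epsilon'}\Big(-\frac1\tau,\frac{z_1}\tau,\frac{z_2}\tau,t-\frac{z_1z_2}\tau\Big)=\frac{(-1)^{4\epsilon\epsilon'}}M\sum_{\substack{a,b\in\epsilon+\mathbb Z\\0\le a,b<M}}e^{-\frac{2\pi i(m+1)}M(ak+bj)}\,\widetilde{\rm ch}^{[M,m;\epsilon']}_{a,b;\epsilon}(\tau,z_1,z_2,t),$$ $$(2)\quad \widetilde{\rm ch}^{[M,m;\epsilon]}_{j,k;\epsilon'}(\tau+1,z_1,z_2,t)=e^{2\pi i\frac{(m+1)jk}M-\pi i\epsilon'}\,\widetilde{\rm ch}^{[M,m;|\epsilon-\epsilon'|]}_{j,k;\epsilon'}(\tau,z_1,z_2,t).$$ Consequently the linear span of the family is $SL_2(\mathbb Z)$-invariant: (3) for every $\begin{pmatrix}a&b\\c&d\end{pmatrix}\in SL_2(\mathbb Z)$ and every member of the family, the function $\widetilde{\rm ch}^{[M,m;\epsilon]}_{j,k;\epsilon'}\big(\frac{a\tau+b}{c\tau+d},\frac{z_1}{c\tau+d},\frac{z_2}{c\tau+d},t-\frac{cz_1z_2}{c\tau+d}\big)$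 is a linear combination, with constant coefficients, of the functions $\widetilde{\rm ch}^{[M,m;\sigma]}_{r,s;\sigma'}(\tau,z_1,z_2,t)$, where $\sigma,\sigma'\in\{0,\tfrac12\}$, $r,s\in\sigma'+\mathbb Z$, $0\le r,s<M$, off the singularities of the whole family (that is, for $z_1,z_2\notin\tfrac12(\mathbb Z+\mathbb Z\tau)$ and $z_1+z_2\notin\mathbb Z+\mathbb Z\tau$). -/

import Mathlib

namespace AdmissibleSl21

noncomputable section

/-- The normalized exponential `e^{2πix}`. With `q = e^{2πiτ}`, the power `q^s` is `ex (s * τ)`. -/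
def ex (x : ℂ) : ℂ := Complex.exp (2 * Real.pi * Complex.I * x)

/-- The degree `k` theta function
`Θ_{j,k}(τ,z) = ∑_{n ∈ ℤ + j/(2k)} q^{k n²} e^{2πi k n z}`. -/
def Theta (j : ℤ) (k : ℕ) (τ z : ℂ) : ℂ :=
  ∑' n : ℤ, ex (k * ((n : ℂ) + j / (2 * k)) ^ 2 * τ + k * ((n : ℂ) + j / (2 * k)) * z)

/-- The mock theta function `Φ^{[m]}`, the numerator of the normalized supercharacter of the
`sl(2|1)^`-module `L(mΛ₀)`. -/
def Phi (m : ℕ) (τ z₁ z₂ t : ℂ) : ℂ :=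
  ex ((m + 1) * t) * ∑' j : ℤ,
    (ex (j * (m + 1) * (z₁ + z₂) + (j : ℂ) ^ 2 * (m + 1) * τ) / (1 - ex (z₁ + j * τ))
      - ex (-(j * (m + 1) * (z₁ + z₂)) + (j : ℂ) ^ 2 * (m + 1) * τ) / (1 - ex (-z₂ + j * τ)))

/-- The odd function `E(x) = 2 ∫₀ˣ e^{-πu²} du`. -/
def zwegersE (x : ℝ) : ℝ := 2 * ∫ u in (0 : ℝ)..x, Real.exp (-Real.pi * u ^ 2)

/-- The summand, for `n ∈ ℤ`, of the functions `R_{m;j}`. -/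
def zwegersRTerm (m : ℕ) (n : ℤ) (τ v : ℂ) : ℂ :=
  ((Real.sign ((n : ℝ) + 1 / 2)
      - zwegersE (((n : ℝ) + 2 * m * (v.im / τ.im)) * Real.sqrt (τ.im / m)) : ℝ) : ℂ)
    * Complex.exp (-(Real.pi * Complex.I * (n : ℂ) ^ 2 / (2 * m)) * τ
        - 2 * Real.pi * Complex.I * n * v)

/-- Zwegers' real analytic function `R_{m;j}(τ,v)`: the sum over all `n ≡ j mod 2m`. -/
def zwegersR (m : ℕ) (j : ℤ) (τ v : ℂ) : ℂ :=
  ∑' k : ℤ, zwegersRTerm m (j + 2 * m * k) τ v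

/-- The real analytic correction term. The summand depends only on `j` modulo `2m+2`. -/
def PhiAdd (m : ℕ) (τ z₁ z₂ t : ℂ) : ℂ :=
  -(1 / 2) * ex ((m + 1) * t) * ∑ j ∈ Finset.range (2 * m + 2),
    zwegersR (m + 1) j τ ((z₁ - z₂) / 2)
      * (Theta j (m + 1) τ (z₁ + z₂) - Theta (-j) (m + 1) τ (z₁ + z₂))

/-- The modified numerator `Φ̃^{[m]} = Φ^{[m]} + Φ^{[m]}_add`. -/
def PhiMod (m : ℕ) (τ z₁ z₂ t : ℂ) : ℂ := Phi m τ z₁ z₂ t + PhiAdd m τ z₁ z₂ t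

/-- The modified functions `Ψ̃^{[M,m;ε]}_{j,k;ε'}`. The formula involves `ε'` only through the
condition `j, k ∈ ε' + ℤ`. -/
def PsiMod (M m : ℕ) (ε j k : ℚ) (τ z₁ z₂ t : ℂ) : ℂ :=
  ex ((m + 1) * j * k / M * τ) * ex ((m + 1) / M * (k * z₁ + j * z₂))
    * PhiMod m (M * τ) (z₁ + j * τ + ε) (z₂ + k * τ + ε) (t / M)

/-- The contribution `∏_{n ≥ 1} (1 - e^{-α} q^{n-1}) (1 - e^{α} q^n)` of a positive root `α` to the
affine superdenominator, where `e^{-α} = e^{2πiz}`. -/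
def rootProduct (τ z : ℂ) : ℂ :=
  ∏' n : ℕ, ((1 - ex (z + n * τ)) * (1 - ex (-z + (n + 1) * τ)))

/-- The affine superdenominator of `sl(2|1)^` (rank 2, dual Coxeter number 1, superdimension 0),
with positive odd roots `α₁, α₂` and positive even root `α₁ + α₂`, in coordinates for which
`e^{-α₁} = e^{2πi z₁}` and `e^{-α₂} = e^{2πi z₂}`. -/
def superdenominator (τ z₁ z₂ t : ℂ) : ℂ :=
  ex t * (∏' n : ℕ, (1 - ex ((n + 1) * τ))) ^ 2 * rootProduct τ (z₁ + z₂)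
    / (rootProduct τ z₁ * rootProduct τ z₂)

/-- The normalized affine denominators `R̂^{(ε)}_{ε'}`, for `ε, ε' ∈ {0, 1/2}`. The shift of
`z₁, z₂` by `ε = 1/2` replaces `1 - e^{±α}q^n` by `1 + e^{±α}q^n` for the odd roots, thus turns the
superdenominator `ε = 0` into the denominator `ε = 1/2`. The twisted (Ramond) versions `ε' = 1/2`
arise from the untwisted ones `ε' = 0` by the translation
`(τ, z₁, z₂, t) ↦ (τ, z₁ + τ/2, z₂ + τ/2, t + (z₁ + z₂)/2 + τ/4)`. -/
def Rhat (ε ε' : ℚ) (τ z₁ z₂ t : ℂ) : ℂ :=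
  superdenominator τ (z₁ + ε' * τ + ε) (z₂ + ε' * τ + ε)
    (t + ε' * (z₁ + z₂) + (ε' : ℂ) ^ 2 * τ)

/-- The modified normalized character (`ε = 1/2`) or supercharacter (`ε = 0`)
`c̃h^{[M,m;ε]}_{j,k;ε'}`, untwisted for `ε' = 0` and twisted for `ε' = 1/2`. -/
def chMod (M m : ℕ) (ε j k ε' : ℚ) (τ z₁ z₂ t : ℂ) : ℂ :=
  PsiMod M m ε j k τ z₁ z₂ t / Rhat ε ε' τ z₁ z₂ t

/-- The values of `ε` and `ε'`. -/
def sectors : Finset ℚ := {0, 1 / 2}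

/-- The index set `{j ∈ ε + ℤ | 0 ≤ j < M}`, for `ε ∈ {0, 1/2}`. -/
def indices (M : ℕ) (ε : ℚ) : Finset ℚ := (Finset.range M).image fun n : ℕ => (n : ℚ) + ε

theorem mem_indices {M : ℕ} {ε : ℚ} (hε : ε ∈ sectors) (j : ℚ) :
    j ∈ indices M ε ↔ (∃ n : ℤ, j = ε + n) ∧ 0 ≤ j ∧ j < M := by
  have h : 0 ≤ ε ∧ ε < 1 := by
    simp only [sectors, Finset.mem_insert, Finset.mem_singleton] at hε
    rcases hε with rfl | rfl <;> norm_num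
  simp only [indices, Finset.mem_image, Finset.mem_range]
  constructor
  · rintro ⟨n, hn, rfl⟩
    refine ⟨⟨n, by push_cast; ring⟩, by have := h.1; positivity, ?_⟩
    have : (n : ℚ) + 1 ≤ M := by exact_mod_cast hn
    linarith [h.2]
  · rintro ⟨⟨n, rfl⟩, h0, h1⟩
    have hn : 0 ≤ n := by
      have : (-1 : ℚ) < n := by linarith [h.2]
      have : (-1 : ℤ) < n := by exact_mod_cast this
      omega
    lift n to ℕ using hn
    refine ⟨n, ?_, by push_cast; ring⟩
    have : (n : ℚ) < M := by
      have := h.1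
      push_cast at h1
      linarith
    exact_mod_cast this

/-- The point `(τ, z₁, z₂)` lies off the singularities of the functions of the sector `(ε, ε')`:
`z₁` and `z₂` are not in `ε + ε'τ + ℤ + ℤτ`, where `R̂^{(ε)}_{ε'}` and the numerators have their
poles, and `z₁ + z₂` is not in `ℤ + ℤτ`, where `R̂^{(ε)}_{ε'}` has its zeros. -/
def Regular (ε ε' : ℚ) (τ z₁ z₂ : ℂ) : Prop :=
  ∀ a b : ℤ, z₁ ≠ ε + ε' * τ + a + b * τ ∧ z₂ ≠ ε + ε' * τ + a + b * τ ∧ z₁ + z₂ ≠ a + b * τ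

end

end AdmissibleSl21

namespace AdmissibleSl21

/-! The real analytic correction turns the numerator into lattice sums on which modularity is
visible. The core is `partial_fraction_gauss`: 1/(1 - e^{2πiw}) plus an error-function series equals
1 plus a sum over b of Gaussian terms divided by w + b. Taken at w = z₁ + lτ, multiplied by a theta
factor and summed over l, it rewrites each of the two Appell–Lerch sums in Φ, together with its
share of the R·Θ correction. Up to an explicit exponential the result is a sum of χ(λ) e^{-πk|Z|²/Im
τ}/Z over Z = z + λ, λ ∈ ℤτ + ℤ, with k = m + 1 and χ a unitary character (`hasSum_appell`); the
leftover theta series cancel between the two halves (`PhiMod_eq`).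

Consequently Ψ̃ is a combination of two such sums over translates of Mℤτ + ℤ (`PsiMod_eq`). T only
shears this lattice. S turns it, up to the scaling by 1/τ, into a translate of ℤτ + Mℤ; the Gaussian
is unchanged and 1/Z contributes a factor τ. The congruence modulo M is detected by additive
characters of ℤ/M, and the other coordinate is split into residues modulo M: this gives the double
sum over (a, b), and it is where M must be prime to m + 1 (`sectorSum_S`).

The denominator is a quotient of theta functions of degree one. Liouville's theorem determines such
a function up to a constant (`theta_one_unique`), and in the quotient the constant cancels, so S
multiplies the denominator by the same τ (`superdenominator_S`) and the characters have weight 0.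
Since S and T generate SL₂(ℤ), and the singular set of the whole family is invariant, the span is
invariant. -/

/-! ### The normalized exponential -/

theorem ex_add (x y : ℂ) : ex (x + y) = ex x * ex y := by
  simp only [ex, ← Complex.exp_add]; ring_nf

theorem ex_neg (x : ℂ) : ex (-x) = (ex x)⁻¹ := by
  simp only [ex, ← Complex.exp_neg]; ring_nf

theorem ex_sub (x y : ℂ) : ex (x - y) = ex x / ex y := by
  rw [sub_eq_add_neg, ex_add, ex_neg, div_eq_mul_inv]

theorem ex_ne_zero (x : ℂ) : ex x ≠ 0 := Complex.exp_ne_zero _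

theorem ex_eq_one_iff (x : ℂ) : ex x = 1 ↔ ∃ n : ℤ, x = n := by
  have h := Complex.two_pi_I_ne_zero
  rw [ex, Complex.exp_eq_one_iff]
  refine exists_congr fun n => ?_
  rw [mul_comm, mul_left_inj' h]

theorem ex_int (n : ℤ) : ex n = 1 := (ex_eq_one_iff _).2 ⟨n, rfl⟩

theorem ex_zero : ex 0 = 1 := by simpa using ex_int 0

theorem ex_half : ex (1 / 2) = -1 := by
  rw [ex, ← Complex.exp_pi_mul_I]; ring_nf

theorem neg_ex (x : ℂ) : -ex x = ex (1 / 2 + x) := by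
  rw [ex_add, ex_half, neg_one_mul]

theorem ex_add_int (x : ℂ) (n : ℤ) : ex (x + n) = ex x := by
  rw [ex_add, ex_int, mul_one]

theorem ex_eq_of_sub_int {x y : ℂ} (n : ℤ) (h : x = y + n) : ex x = ex y := by
  rw [h, ex_add_int]

theorem norm_ex (x : ℂ) : ‖ex x‖ = Real.exp (-(2 * Real.pi * x.im)) := by
  rw [ex, Complex.norm_exp]
  congr 1
  simp [Complex.mul_re, Complex.mul_im]

theorem differentiable_ex : Differentiable ℂ ex := by
  unfold ex; fun_prop

theorem ex_int_mul (n : ℤ) (x : ℂ) : ex (n * x) = ex x ^ n := by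
  rw [ex, ex, ← Complex.exp_int_mul]; ring_nf

/-! ### Infinite products -/

/-- The product `∏_{n ≥ 0} (1 - e^{2πiz} q^n)`. -/
noncomputable def qProduct (τ z : ℂ) : ℂ := ∏' n : ℕ, (1 - ex (z + n * τ))

theorem norm_ex_lt_one {τ : ℂ} (hτ : 0 < τ.im) : ‖ex τ‖ < 1 := by
  rw [norm_ex, Real.exp_lt_one_iff]
  have := Real.pi_pos
  nlinarith [mul_pos this hτ]

theorem norm_ex_add_nat_mul (τ z : ℂ) (n : ℕ) : ‖ex (z + n * τ)‖ = ‖ex z‖ * ‖ex τ‖ ^ n := by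
  have := ex_int_mul n τ
  push_cast at this
  rw [ex_add, this, norm_mul, zpow_natCast, norm_pow]

theorem summable_norm_ex {τ : ℂ} (hτ : 0 < τ.im) (z : ℂ) :
    Summable fun n : ℕ => ‖-ex (z + n * τ)‖ := by
  simp only [norm_neg, norm_ex_add_nat_mul]
  exact (summable_geometric_of_lt_one (norm_nonneg _) (norm_ex_lt_one hτ)).mul_left _

theorem multipliable_qProduct {τ : ℂ} (hτ : 0 < τ.im) (z : ℂ) :
    Multipliable fun n : ℕ => (1 - ex (z + n * τ)) := by
  simpa only [sub_eq_add_neg] using multipliable_one_add_of_summable (summable_norm_ex hτ z)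

theorem qProduct_eq_mul {τ : ℂ} (hτ : 0 < τ.im) (z : ℂ) :
    qProduct τ z = (1 - ex z) * qProduct τ (z + τ) := by
  have h : ∀ n : ℕ, z + ((n + 1 : ℕ) : ℂ) * τ = z + τ + n * τ := fun n => by push_cast; ring
  rw [qProduct, qProduct, tprod_eq_zero_mul']
  · simp only [h]; simp
  · simpa only [h] using multipliable_qProduct hτ (z + τ)

theorem qProduct_eq_zero_iff {τ : ℂ} (hτ : 0 < τ.im) (z : ℂ) :
    qProduct τ z = 0 ↔ ∃ n : ℕ, ex (z + n * τ) = 1 := by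
  constructor
  · intro h
    by_contra! hc
    refine tprod_one_add_ne_zero_of_summable (fun n => ?_) (summable_norm_ex hτ z) ?_
    · rw [← sub_eq_add_neg, sub_ne_zero]; exact (hc n).symm
    · simpa only [qProduct, ← sub_eq_add_neg] using h
  · rintro ⟨n, hn⟩
    exact tprod_of_exists_eq_zero ⟨n, by rw [hn, sub_self]⟩

theorem differentiable_qProduct {τ : ℂ} (hτ : 0 < τ.im) : Differentiable ℂ (qProduct τ) := by
  intro z₀
  -- On a half-plane bounded below the factors differ from 1 by at most a fixed geometric sequence,
  -- so the product converges locally uniformly there.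
  let U : Set ℂ := {z | z₀.im - 1 < z.im}
  have hU : IsOpen U := isOpen_lt continuous_const Complex.continuous_im
  have hu : Summable fun n : ℕ => Real.exp (-(2 * Real.pi * (z₀.im - 1))) * ‖ex τ‖ ^ n :=
    (summable_geometric_of_lt_one (norm_nonneg _) (norm_ex_lt_one hτ)).mul_left _
  have h := hu.hasProdLocallyUniformlyOn_nat_one_add (f := fun n z => -ex (z + n * τ)) hU
    (Filter.Eventually.of_forall fun n z hz => by
      rw [norm_neg, norm_ex_add_nat_mul, norm_ex]
      have : z₀.im - 1 < z.im := hz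
      gcongr)
    (fun n => (differentiable_ex.continuous.comp (by fun_prop)).neg.continuousOn)
  have hi : ∀ i : ℕ, Differentiable ℂ fun z => 1 + -ex (z + i * τ) := fun i =>
    (differentiable_ex.comp (by fun_prop : Differentiable ℂ fun z : ℂ => z + i * τ)).neg.const_add 1
  have hd := h.differentiableOn (Filter.Eventually.of_forall fun s =>
    DifferentiableOn.fun_finsetProd fun i _ => (hi i).differentiableOn) hU
  have := hd.differentiableAt (hU.mem_nhds (show z₀ ∈ U by simp [U]))
  have e : qProduct τ = fun z => ∏' n : ℕ, (1 + -ex (z + n * τ)) := by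
    funext z; simp only [qProduct, sub_eq_add_neg]
  rwa [e]

theorem rootProduct_eq {τ : ℂ} (hτ : 0 < τ.im) (z : ℂ) :
    rootProduct τ z = qProduct τ z * qProduct τ (τ - z) := by
  have h : ∀ n : ℕ, -z + ((n : ℂ) + 1) * τ = τ - z + n * τ := fun n => by ring
  simp only [rootProduct, qProduct, h]
  exact (multipliable_qProduct hτ z).tprod_mul (multipliable_qProduct hτ (τ - z))

theorem differentiable_rootProduct {τ : ℂ} (hτ : 0 < τ.im) : Differentiable ℂ (rootProduct τ) := by
  have h : rootProduct τ = fun z => qProduct τ z * qProduct τ (τ - z) :=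
    funext (rootProduct_eq hτ)
  rw [h]
  exact (differentiable_qProduct hτ).mul ((differentiable_qProduct hτ).comp (by fun_prop))

theorem rootProduct_add_one (τ z : ℂ) : rootProduct τ (z + 1) = rootProduct τ z := by
  refine tprod_congr fun n => ?_
  rw [ex_eq_of_sub_int (x := z + 1 + n * τ) (y := z + n * τ) 1 (by push_cast; ring),
    ex_eq_of_sub_int (x := -(z + 1) + (n + 1) * τ) (y := -z + (n + 1) * τ) (-1) (by push_cast; ring)]

theorem rootProduct_add_tau {τ : ℂ} (hτ : 0 < τ.im) (z : ℂ) :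
    rootProduct τ (z + τ) = -ex (-z) * rootProduct τ z := by
  rw [rootProduct_eq hτ, rootProduct_eq hτ, qProduct_eq_mul hτ z,
    show τ - (z + τ) = -z by ring, qProduct_eq_mul hτ (-z), show -z + τ = τ - z by ring, ex_neg]
  have := ex_ne_zero z
  field_simp
  ring

theorem rootProduct_eq_zero_iff {τ : ℂ} (hτ : 0 < τ.im) (z : ℂ) :
    rootProduct τ z = 0 ↔ ∃ a b : ℤ, z = a + b * τ := by
  rw [rootProduct_eq hτ, mul_eq_zero, qProduct_eq_zero_iff hτ, qProduct_eq_zero_iff hτ]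
  simp only [ex_eq_one_iff]
  constructor
  · rintro (⟨n, a, h⟩ | ⟨n, a, h⟩)
    · exact ⟨a, -n, by push_cast; linear_combination h⟩
    · exact ⟨-a, n + 1, by push_cast; linear_combination -h⟩
  · rintro ⟨a, b, h⟩
    rcases le_or_gt b 0 with hb | hb
    · obtain ⟨n, hn⟩ := Int.eq_ofNat_of_zero_le (neg_nonneg.2 hb)
      refine Or.inl ⟨n, a, ?_⟩
      have : (n : ℂ) = -b := by exact_mod_cast hn.symm
      rw [this]; linear_combination h
    · obtain ⟨n, hn⟩ := Int.eq_ofNat_of_zero_le (show 0 ≤ b - 1 by omega)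
      refine Or.inr ⟨n, -a, ?_⟩
      have : (n : ℂ) = b - 1 := by exact_mod_cast hn.symm
      rw [this]; push_cast; linear_combination -h

theorem qProduct_self_ne_zero {τ : ℂ} (hτ : 0 < τ.im) : qProduct τ τ ≠ 0 := by
  rw [Ne, qProduct_eq_zero_iff hτ]
  rintro ⟨n, h⟩
  have h2 := norm_ex_add_nat_mul τ τ n
  rw [h, norm_one, ← pow_succ'] at h2
  exact absurd h2.symm (pow_lt_one₀ (norm_nonneg _) (norm_ex_lt_one hτ) (by omega)).ne

/-- The zero at 0 sits in the single factor 1 - e^{2πiz}. The derivative fixes the constant of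
proportionality in the transformation under S. -/
theorem hasDerivAt_rootProduct_zero {τ : ℂ} (hτ : 0 < τ.im) :
    HasDerivAt (rootProduct τ) (-(2 * Real.pi * Complex.I) * qProduct τ τ ^ 2) 0 := by
  have h : rootProduct τ = fun z => (1 - ex z) * (qProduct τ (z + τ) * qProduct τ (τ - z)) :=
    funext fun z => by rw [rootProduct_eq hτ, qProduct_eq_mul hτ z, mul_assoc]
  have h1 : HasDerivAt (fun z => 1 - ex z) (-(2 * Real.pi * Complex.I)) 0 := by
    have : HasDerivAt ex (2 * Real.pi * Complex.I) 0 := by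
      have := ((hasDerivAt_id (0 : ℂ)).const_mul (2 * Real.pi * Complex.I)).cexp
      simpa using! this
    simpa using this.const_sub 1
  have h2 : DifferentiableAt ℂ (fun z => qProduct τ (z + τ) * qProduct τ (τ - z)) 0 :=
    (((differentiable_qProduct hτ).comp (by fun_prop : Differentiable ℂ fun z : ℂ => z + τ)).mul
      ((differentiable_qProduct hτ).comp (by fun_prop : Differentiable ℂ fun z : ℂ => τ - z))) 0
  rw [h]
  convert! h1.mul h2.hasDerivAt using 1
  simp [ex_zero]
  ring

/-! ### Uniqueness of theta functions of degree one -/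

theorem exists_real_coords {τ : ℂ} (hτ : 0 < τ.im) (z : ℂ) :
    z = ((z.im / τ.im : ℝ) : ℂ) * τ + ((z.re - z.im / τ.im * τ.re : ℝ) : ℂ) := by
  apply Complex.ext
  · simp
  · simp [hτ.ne']

/-- Liouville: by double periodicity all values are taken on one compact period parallelogram. -/
theorem elliptic_eq_const {τ : ℂ} (hτ : 0 < τ.im) {H : ℂ → ℂ} (hd : Differentiable ℂ H)
    (h1 : Function.Periodic H 1) (h2 : Function.Periodic H τ) (z w : ℂ) : H z = H w := by
  refine hd.apply_eq_apply_of_bounded ?_ z w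
  have hK : IsCompact ((fun x : ℝ × ℝ => H ((x.1 : ℂ) * τ + x.2)) '' (Set.Icc 0 1 ×ˢ Set.Icc 0 1)) :=
    (isCompact_Icc.prod isCompact_Icc).image (hd.continuous.comp (by fun_prop))
  refine hK.isBounded.subset ?_
  rintro _ ⟨z, rfl⟩
  set p := z.im / τ.im
  set q := z.re - z.im / τ.im * τ.re
  refine ⟨(Int.fract p, Int.fract q),
    ⟨⟨Int.fract_nonneg _, (Int.fract_lt_one _).le⟩, ⟨Int.fract_nonneg _, (Int.fract_lt_one _).le⟩⟩, ?_⟩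
  have hz : z = ((Int.fract p : ℝ) : ℂ) * τ + (Int.fract q : ℝ) + (⌊q⌋ : ℤ) * 1 + (⌊p⌋ : ℤ) * τ := by
    conv_lhs => rw [exists_real_coords hτ z]
    have e1 : ((Int.fract p : ℝ) : ℂ) = (p : ℂ) - (⌊p⌋ : ℤ) := by
      rw [← Int.self_sub_floor]; push_cast; rfl
    have e2 : ((Int.fract q : ℝ) : ℂ) = (q : ℂ) - (⌊q⌋ : ℤ) := by
      rw [← Int.self_sub_floor]; push_cast; rfl
    rw [e1, e2]; ring
  dsimp only
  conv_rhs => rw [hz, h2.int_mul ⌊p⌋ _, h1.int_mul ⌊q⌋ _]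

/-- The multipliers of f and g agree, so f/g is elliptic. The zero of g at 0 is simple and f
vanishes there too, so the quotient is regular at 0, and by periodicity at every lattice point; it
is therefore constant. -/
theorem theta_one_unique {τ : ℂ} (hτ : 0 < τ.im) {f g : ℂ → ℂ}
    (hf : Differentiable ℂ f) (hg : Differentiable ℂ g)
    (hf1 : ∀ z, f (z + 1) = f z) (hg1 : ∀ z, g (z + 1) = g z)
    (hf2 : ∀ z, f (z + τ) = -ex (-z) * f z) (hg2 : ∀ z, g (z + τ) = -ex (-z) * g z)
    (hf0 : f 0 = 0) (hg0 : ∀ z, g z = 0 ↔ ∃ a b : ℤ, z = a + b * τ) (hg' : deriv g 0 ≠ 0) :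
    ∃ c, (∀ z, f z = c * g z) ∧ deriv f 0 = c * deriv g 0 := by
  classical
  set c := deriv f 0 / deriv g 0 with hc
  -- The removable singularities of f/g are filled with the limit at 0 given by the derivatives; one
  -- value serves at all zeros of g, as they are translates of 0.
  let H : ℂ → ℂ := fun z => if g z = 0 then c else f z / g z
  have hg00 : g 0 = 0 := (hg0 0).2 ⟨0, 0, by simp⟩
  have h1 : Function.Periodic H 1 := fun z => by simp only [H, hg1, hf1]
  have h2 : Function.Periodic H τ := fun z => by
    have := ex_ne_zero (-z)
    simp only [H, hg2, hf2, mul_eq_zero, neg_eq_zero, this, false_or]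
    split_ifs with h
    · rfl
    · field_simp
  have hdf : DifferentiableAt ℂ (dslope f 0) 0 :=
    ((Complex.differentiableOn_dslope (s := Set.univ) Filter.univ_mem).2
      hf.differentiableOn).differentiableAt Filter.univ_mem
  have hdg : DifferentiableAt ℂ (dslope g 0) 0 :=
    ((Complex.differentiableOn_dslope (s := Set.univ) Filter.univ_mem).2
      hg.differentiableOn).differentiableAt Filter.univ_mem
  -- Near 0 the common factor z is removed from f and g: H is the quotient of their difference
  -- quotients.
  have hH0 : DifferentiableAt ℂ H 0 := by
    refine (hdf.div hdg (by rwa [dslope_same])).congr_of_eventuallyEq ?_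
    have hne : ∀ᶠ z in nhds (0 : ℂ), dslope g 0 z ≠ 0 :=
      hdg.continuousAt.eventually_ne (by rwa [dslope_same])
    filter_upwards [hne] with z hz
    rcases eq_or_ne z 0 with rfl | hz0
    · simp [H, hg00, hc, dslope_same]
    · have e1 : g z = z * dslope g 0 z := by
        rw [dslope_of_ne _ hz0, slope_def_field, hg00]; field_simp; ring
      have e2 : f z = z * dslope f 0 z := by
        rw [dslope_of_ne _ hz0, slope_def_field, hf0]; field_simp; ring
      have : g z ≠ 0 := by rw [e1]; exact mul_ne_zero hz0 hz
      simp only [H, if_neg this, Pi.div_apply]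
      rw [e1, e2]
      field_simp
  have hH : Differentiable ℂ H := by
    intro z
    by_cases hz : g z = 0
    · obtain ⟨a, b, rfl⟩ := (hg0 z).1 hz
      have e : H = fun w => H (w - (a + b * τ)) := by
        funext w
        have := h2.int_mul b (w - (a + b * τ) + a * 1)
        rw [h1.int_mul a] at this
        rw [← this]; congr 1; ring
      rw [e]
      have : DifferentiableAt ℂ H ((a + b * τ : ℂ) - (a + b * τ)) := by rwa [sub_self]
      exact this.comp (f := fun w : ℂ => w - (a + b * τ)) _ (by fun_prop)
    · refine (hf.differentiableAt.div hg.differentiableAt hz).congr_of_eventuallyEq ?_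
      filter_upwards [hg.continuous.continuousAt.eventually_ne hz] with w hw
      simp [H, hw]
  refine ⟨c, fun z => ?_, by rw [hc]; field_simp⟩
  have hcon := elliptic_eq_const hτ hH h1 h2 z 0
  simp only [H, hg00, if_true] at hcon
  split_ifs at hcon with h
  · rw [h, mul_zero]
    obtain ⟨a, b, rfl⟩ := (hg0 z).1 h
    -- At a zero of g the constancy of H carries no information, so the vanishing of f is propagated
    -- from 0 by quasi-periodicity.
    have hq : ∀ b : ℤ, f (b * τ) = 0 := by
      intro b
      induction b with
      | zero => simpa using hf0
      | succ n ih =>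
        push_cast at ih ⊢
        rw [add_mul, one_mul, hf2, ih, mul_zero]
      | pred n ih =>
        have := hf2 ((-(n : ℤ) - 1 : ℤ) * τ)
        push_cast at this ih ⊢
        rw [show (-(n : ℂ) - 1) * τ + τ = -n * τ by ring, ih] at this
        have h3 := ex_ne_zero (-((-(n : ℂ) - 1) * τ))
        simpa [h3] using this.symm
    have hp : Function.Periodic f 1 := hf1
    have := hp.int_mul a (b * τ)
    rw [add_comm, ← mul_one (a : ℂ), this, hq]
  · rw [← hcon]; field_simp

/-! ### The affine superdenominator -/

theorem neg_inv_im_pos {τ : ℂ} (hτ : 0 < τ.im) : 0 < (-1 / τ).im := by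
  have h0 : τ ≠ 0 := by rintro rfl; simp at hτ
  rw [neg_div, one_div, Complex.neg_im, Complex.inv_im, neg_div, neg_neg]
  exact div_pos hτ (Complex.normSq_pos.2 h0)

/-- Divided by the Gaussian factor, the left side has the multipliers of `rootProduct τ` under z + 1
and z + τ and vanishes at 0, so `theta_one_unique` applies. Comparing derivatives at 0 gives the
only relation on c that is needed; its value, which would require the transformation of the eta
function, is not. -/
theorem rootProduct_S {τ : ℂ} (hτ : 0 < τ.im) :
    ∃ c : ℂ, c * τ * qProduct τ τ ^ 2 = qProduct (-1 / τ) (-1 / τ) ^ 2 ∧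
      ∀ z, rootProduct (-1 / τ) (z / τ) =
        c * ex (z ^ 2 / (2 * τ) + z / (2 * τ) - z / 2) * rootProduct τ z := by
  have h0 : τ ≠ 0 := by rintro rfl; simp at hτ
  have hτ' := neg_inv_im_pos hτ
  let e : ℂ → ℂ := fun z => ex (-(z ^ 2 / (2 * τ) + z / (2 * τ) - z / 2))
  have he : Differentiable ℂ e := differentiable_ex.comp (by fun_prop)
  have hr := differentiable_rootProduct hτ'
  have hr' : Differentiable ℂ fun z => rootProduct (-1 / τ) (z / τ) :=
    hr.comp (by fun_prop : Differentiable ℂ fun z : ℂ => z / τ)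
  have hroot0 : rootProduct (-1 / τ) 0 = 0 :=
    (rootProduct_eq_zero_iff hτ' 0).2 ⟨0, 0, by simp⟩
  have key : ∃ c, (∀ z, e z * rootProduct (-1 / τ) (z / τ) = c * rootProduct τ z) ∧
      deriv (fun z => e z * rootProduct (-1 / τ) (z / τ)) 0 = c * deriv (rootProduct τ) 0 := by
    refine theta_one_unique hτ (he.mul hr')
      (differentiable_rootProduct hτ) ?_ (rootProduct_add_one τ) ?_ (rootProduct_add_tau hτ) ?_
      (rootProduct_eq_zero_iff hτ) ?_
    · intro z
      have h1 := rootProduct_add_tau hτ' ((z + 1) / τ)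
      rw [show (z + 1) / τ + -1 / τ = z / τ by field_simp; ring] at h1
      simp only [e]
      rw [h1, ← mul_assoc, mul_neg, ← ex_add]
      congr 1
      rw [neg_ex]
      refine ex_eq_of_sub_int 0 ?_
      push_cast
      field_simp
      ring
    · intro z
      simp only [e]
      rw [show (z + τ) / τ = z / τ + 1 by field_simp, rootProduct_add_one, ← mul_assoc]
      congr 1
      rw [neg_ex, ← ex_add]
      refine ex_eq_of_sub_int (-1) ?_
      push_cast
      field_simp
      ring
    · simp [hroot0]
    · rw [(hasDerivAt_rootProduct_zero hτ).deriv]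
      exact mul_ne_zero (neg_ne_zero.2 Complex.two_pi_I_ne_zero)
        (pow_ne_zero _ (qProduct_self_ne_zero hτ))
  obtain ⟨c, hc, hcd⟩ := key
  refine ⟨c, ?_, fun z => ?_⟩
  · have hq : HasDerivAt (fun z => rootProduct (-1 / τ) (z / τ))
        (-(2 * Real.pi * Complex.I) * qProduct (-1 / τ) (-1 / τ) ^ 2 * (1 / τ)) 0 := by
      have h1 : HasDerivAt (fun z : ℂ => z / τ) (1 / τ) 0 := (hasDerivAt_id (0 : ℂ)).div_const τ
      have h2 := hasDerivAt_rootProduct_zero hτ'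
      rw [← zero_div τ] at h2
      exact h2.comp (0 : ℂ) h1
    have h3 := (he.differentiableAt (x := 0)).hasDerivAt.mul hq
    have h4 := h3.deriv
    have e0 : e 0 = 1 := by simp [e, ex_zero]
    change deriv (fun z => e z * rootProduct (-1 / τ) (z / τ)) 0 = _ at h4
    rw [hcd, (hasDerivAt_rootProduct_zero hτ).deriv, zero_div, hroot0, mul_zero, zero_add, e0] at h4
    have hpi := Complex.two_pi_I_ne_zero
    generalize qProduct (-1 / τ) (-1 / τ) = Q at h4 ⊢
    field_simp at h4
    linear_combination -h4
  · have := hc z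
    simp only [e] at this
    rw [ex_neg] at this
    have h5 := ex_ne_zero (z ^ 2 / (2 * τ) + z / (2 * τ) - z / 2)
    rw [mul_right_comm, ← this, mul_right_comm, inv_mul_cancel₀ h5, one_mul]

theorem superdenominator_eq (τ z₁ z₂ t : ℂ) :
    superdenominator τ z₁ z₂ t = ex t * qProduct τ τ ^ 2 * rootProduct τ (z₁ + z₂)
      / (rootProduct τ z₁ * rootProduct τ z₂) := by
  rw [superdenominator, qProduct]
  congr 5
  funext n
  rw [show ((n : ℂ) + 1) * τ = τ + n * τ by ring]

/-- The constant c occurs twice above (once through the squared Euler product, once through the even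
root) and twice below (the odd roots), and cancels; the factor τ from the Euler product survives. -/
theorem superdenominator_S {τ : ℂ} (hτ : 0 < τ.im) (z₁ z₂ t : ℂ) :
    superdenominator (-1 / τ) (z₁ / τ) (z₂ / τ) (t - z₁ * z₂ / τ) =
      τ * superdenominator τ z₁ z₂ t := by
  have h0 : τ ≠ 0 := by rintro rfl; simp at hτ
  obtain ⟨c, hc, h⟩ := rootProduct_S hτ
  have hc0 : c ≠ 0 := by
    rintro rfl
    exact pow_ne_zero 2 (qProduct_self_ne_zero (neg_inv_im_pos hτ)) (by simpa using hc.symm)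
  rw [superdenominator_eq, superdenominator_eq, ← add_div, h, h, h, ← hc]
  set g : ℂ → ℂ := fun z => ex (z ^ 2 / (2 * τ) + z / (2 * τ) - z / 2) with hg
  have hg0 : ∀ z, g z ≠ 0 := fun z => ex_ne_zero _
  have hgg : ex (t - z₁ * z₂ / τ) * g (z₁ + z₂) = ex t * (g z₁ * g z₂) := by
    simp only [hg, ← ex_add]
    congr 1
    field_simp
    ring
  have h1 := hg0 z₁
  have h2 := hg0 z₂
  calc ex (t - z₁ * z₂ / τ) * (c * τ * qProduct τ τ ^ 2) * (c * g (z₁ + z₂) * rootProduct τ (z₁ + z₂)) /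
      (c * g z₁ * rootProduct τ z₁ * (c * g z₂ * rootProduct τ z₂))
      = (ex (t - z₁ * z₂ / τ) * g (z₁ + z₂)) * (c * τ * qProduct τ τ ^ 2) * (c * rootProduct τ (z₁ + z₂)) /
      (c * g z₁ * rootProduct τ z₁ * (c * g z₂ * rootProduct τ z₂)) := by ring
    _ = ((c * c * g z₁ * g z₂) * (τ * (ex t * qProduct τ τ ^ 2 * rootProduct τ (z₁ + z₂)))) /
      ((c * c * g z₁ * g z₂) * (rootProduct τ z₁ * rootProduct τ z₂)) := by rw [hgg]; ring
    _ = _ := by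
      rw [mul_div_mul_left _ _ (mul_ne_zero (mul_ne_zero (mul_ne_zero hc0 hc0) h1) h2)]; ring

theorem rootProduct_add_int (τ z : ℂ) (a : ℤ) : rootProduct τ (z + a) = rootProduct τ z := by
  have h : Function.Periodic (rootProduct τ) 1 := rootProduct_add_one τ
  simpa using h.int_mul a z

theorem superdenominator_add_int (τ z₁ z₂ t : ℂ) (a b c : ℤ) :
    superdenominator τ (z₁ + a) (z₂ + b) (t + c) = superdenominator τ z₁ z₂ t := by
  rw [superdenominator, superdenominator, rootProduct_add_int, rootProduct_add_int, ex_add_int,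
    show z₁ + a + (z₂ + b) = z₁ + z₂ + ((a + b : ℤ) : ℂ) by push_cast; ring, rootProduct_add_int]

theorem rootProduct_T (τ z : ℂ) : rootProduct (τ + 1) z = rootProduct τ z := by
  refine tprod_congr fun n => ?_
  rw [ex_eq_of_sub_int (x := z + n * (τ + 1)) (y := z + n * τ) n (by push_cast; ring),
    ex_eq_of_sub_int (x := -z + (n + 1) * (τ + 1)) (y := -z + (n + 1) * τ) (n + 1)
      (by push_cast; ring)]

theorem superdenominator_T (τ z₁ z₂ t : ℂ) :
    superdenominator (τ + 1) z₁ z₂ t = superdenominator τ z₁ z₂ t := by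
  have h : ∀ n : ℕ, ex (((n : ℂ) + 1) * (τ + 1)) = ex ((n + 1) * τ) := fun n =>
    ex_eq_of_sub_int (n + 1) (by push_cast; ring)
  simp only [superdenominator, rootProduct_T, h]

/-! ### The four denominators under S and T -/

theorem mem_sectors {ε : ℚ} (h : ε ∈ sectors) : ε = 0 ∨ ε = 1 / 2 := by
  simpa [sectors] using h

/-- Division by τ exchanges the shifts by ε'τ and ε, up to the sign of ε'. That sign is repaired by
the integer 2ε', and completing the product in the t-variable costs e^{-4πiεε'}. -/
theorem Rhat_S {ε ε' : ℚ} (hε' : ε' ∈ sectors) {τ : ℂ} (hτ : 0 < τ.im) (z₁ z₂ t : ℂ) :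
    Rhat ε ε' (-1 / τ) (z₁ / τ) (z₂ / τ) (t - z₁ * z₂ / τ) =
      τ * ex (-2 * ε * ε') * Rhat ε' ε τ z₁ z₂ t := by
  have h0 : τ ≠ 0 := by rintro rfl; simp at hτ
  obtain ⟨n, hn⟩ : ∃ n : ℤ, (2 * (ε' : ℂ)) = n := by
    rcases mem_sectors hε' with rfl | rfl
    · exact ⟨0, by simp⟩
    · exact ⟨1, by norm_num⟩
  have h := superdenominator_S hτ (z₁ - ε' + ε * τ) (z₂ - ε' + ε * τ)
    (t + ε * (z₁ + z₂) + (ε : ℂ) ^ 2 * τ - 2 * ε * ε')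
  rw [Rhat, Rhat]
  have e : ∀ z : ℂ, z / τ + ε' * (-1 / τ) + ε = (z - ε' + ε * τ) / τ := fun z => by
    field_simp; ring
  rw [e, e, show t - z₁ * z₂ / τ + ε' * (z₁ / τ + z₂ / τ) + (ε' : ℂ) ^ 2 * (-1 / τ) =
    t + ε * (z₁ + z₂) + (ε : ℂ) ^ 2 * τ - 2 * ε * ε'
      - (z₁ - ε' + ε * τ) * (z₂ - ε' + ε * τ) / τ by field_simp; ring, h]
  have h2 := superdenominator_add_int τ (z₁ - ε' + ε * τ) (z₂ - ε' + ε * τ)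
    (t + ε * (z₁ + z₂) + (ε : ℂ) ^ 2 * τ - 2 * ε * ε') n n 0
  rw [← h2, ← hn]
  rw [show z₁ - ε' + ε * τ + 2 * (ε' : ℂ) = z₁ + ε * τ + ε' by ring,
    show z₂ - ε' + ε * τ + 2 * (ε' : ℂ) = z₂ + ε * τ + ε' by ring]
  simp only [superdenominator]
  rw [show t + ε * (z₁ + z₂) + (ε : ℂ) ^ 2 * τ - 2 * ε * ε' + ((0 : ℤ) : ℂ) =
    -2 * ε * ε' + (t + ε * (z₁ + z₂) + (ε : ℂ) ^ 2 * τ) by push_cast; ring, ex_add]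
  ring

theorem Rhat_T {ε ε' : ℚ} (hε : ε ∈ sectors) (hε' : ε' ∈ sectors) (τ z₁ z₂ t : ℂ) :
    Rhat ε ε' (τ + 1) z₁ z₂ t = ex (ε' / 2) * Rhat |ε - ε'| ε' τ z₁ z₂ t := by
  obtain ⟨n, hn⟩ : ∃ n : ℤ, (ε' : ℂ) + ε = ((|ε - ε'| : ℚ) : ℂ) + n := by
    rcases mem_sectors hε with rfl | rfl <;> rcases mem_sectors hε' with rfl | rfl
    · exact ⟨0, by simp⟩
    · exact ⟨0, by norm_num [abs_of_nonpos]⟩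
    · exact ⟨0, by norm_num [abs_of_nonneg]⟩
    · exact ⟨1, by norm_num⟩
  -- True only because ε' is 0 or 1/2; this is the source of the phase e^{πiε'}.
  have hsq : (ε' : ℂ) ^ 2 = ε' / 2 := by
    rcases mem_sectors hε' with rfl | rfl <;> norm_num
  have e : ∀ z : ℂ, z + ε' * (τ + 1) + ε = z + ε' * τ + (|ε - ε'| : ℚ) + n := fun z => by
    linear_combination hn
  rw [Rhat, Rhat, superdenominator_T, e, e]
  have h2 := superdenominator_add_int τ (z₁ + ε' * τ + (|ε - ε'| : ℚ)) (z₂ + ε' * τ + (|ε - ε'| : ℚ))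
    (t + ε' * (z₁ + z₂) + (ε' : ℂ) ^ 2 * (τ + 1)) n n 0
  rw [Int.cast_zero, add_zero] at h2
  rw [h2]
  simp only [superdenominator]
  rw [show t + ε' * (z₁ + z₂) + (ε' : ℂ) ^ 2 * (τ + 1) =
    ε' / 2 + (t + ε' * (z₁ + z₂) + (ε' : ℂ) ^ 2 * τ) by linear_combination hsq, ex_add]
  ring

/-! ### The function `E` -/

theorem continuous_exp_neg_pi_sq : Continuous fun u : ℝ => Real.exp (-Real.pi * u ^ 2) := by
  fun_prop

theorem hasDerivAt_zwegersE (x : ℝ) :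
    HasDerivAt zwegersE (2 * Real.exp (-Real.pi * x ^ 2)) x :=
  (intervalIntegral.integral_hasDerivAt_right (continuous_exp_neg_pi_sq.intervalIntegrable _ _)
    continuous_exp_neg_pi_sq.stronglyMeasurable.stronglyMeasurableAtFilter
    continuous_exp_neg_pi_sq.continuousAt).const_mul 2

theorem zwegersE_neg (x : ℝ) : zwegersE (-x) = -zwegersE x := by
  have h := intervalIntegral.integral_comp_neg (a := x) (b := 0)
    (fun u => Real.exp (-Real.pi * u ^ 2))
  simp only [neg_sq, neg_zero] at h
  rw [zwegersE, zwegersE, ← h, intervalIntegral.integral_symm]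
  ring

theorem tendsto_zwegersE : Filter.Tendsto zwegersE Filter.atTop (nhds 1) := by
  have h := MeasureTheory.intervalIntegral_tendsto_integral_Ioi 0
    (integrable_exp_neg_mul_sq Real.pi_pos).integrableOn Filter.tendsto_id
  rw [integral_gaussian_Ioi, div_self Real.pi_ne_zero, Real.sqrt_one] at h
  have h2 := h.const_mul 2
  rw [show (2 : ℝ) * (1 / 2) = 1 by norm_num] at h2
  exact h2

theorem zwegersE_le_one (x : ℝ) : zwegersE x ≤ 1 := by
  have hm : Monotone zwegersE := monotone_of_deriv_nonneg
    (fun x => (hasDerivAt_zwegersE x).differentiableAt) fun x => by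
      rw [(hasDerivAt_zwegersE x).deriv]; positivity
  exact hm.ge_of_tendsto tendsto_zwegersE x

theorem one_sub_zwegersE_le {x : ℝ} (hx : 0 ≤ x) :
    1 - zwegersE x ≤ Real.exp (-Real.pi * x ^ 2) := by
  have hπ := Real.pi_pos
  -- φ starts at 1, increases up to 1/π, then decreases to its limit 1; hence it is never below 1.
  let φ : ℝ → ℝ := fun x => Real.exp (-Real.pi * x ^ 2) + zwegersE x
  have hφ : ∀ x, HasDerivAt φ (2 * Real.exp (-Real.pi * x ^ 2) * (1 - Real.pi * x)) x := fun x => by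
    have h1 : HasDerivAt (fun x : ℝ => Real.exp (-Real.pi * x ^ 2))
        (Real.exp (-Real.pi * x ^ 2) * (-Real.pi * (2 * x))) x := by
      have := ((hasDerivAt_pow 2 x).const_mul (-Real.pi)).exp
      simpa using this
    refine (h1.add (hasDerivAt_zwegersE x)).congr_deriv ?_
    ring
  have hc : Continuous φ := continuous_iff_continuousAt.2 fun x => (hφ x).continuousAt
  suffices h : 1 ≤ φ x by simp only [φ] at h; linarith
  rcases le_total x (1 / Real.pi) with h | h
  · have hm : MonotoneOn φ (Set.Icc 0 (1 / Real.pi)) :=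
      monotoneOn_of_deriv_nonneg (convex_Icc _ _) hc.continuousOn
        (fun y _ => (hφ y).differentiableAt.differentiableWithinAt) fun y hy => by
          rw [interior_Icc] at hy
          rw [(hφ y).deriv]
          have : Real.pi * y ≤ 1 := by
            have := hy.2.le; rwa [le_div_iff₀ hπ, mul_comm] at this
          have : 0 ≤ 1 - Real.pi * y := by linarith
          positivity
    have := hm (Set.left_mem_Icc.2 (by positivity)) ⟨hx, h⟩ hx
    simpa [φ, zwegersE] using this
  · have hm : AntitoneOn φ (Set.Ici (1 / Real.pi)) :=
      antitoneOn_of_deriv_nonpos (convex_Ici _) hc.continuousOn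
        (fun y _ => (hφ y).differentiableAt.differentiableWithinAt) fun y hy => by
          rw [interior_Ici] at hy
          rw [(hφ y).deriv]
          have : 1 ≤ Real.pi * y := by
            have := (show 1 / Real.pi < y from hy).le; rwa [div_le_iff₀ hπ, mul_comm] at this
          have h0 : 1 - Real.pi * y ≤ 0 := by linarith
          exact mul_nonpos_of_nonneg_of_nonpos (by positivity) h0
    have ht : Filter.Tendsto φ Filter.atTop (nhds (0 + 1)) := by
      refine Filter.Tendsto.add ?_ tendsto_zwegersE
      refine Real.tendsto_exp_atBot.comp ?_
      exact (Filter.tendsto_pow_atTop two_ne_zero).const_mul_atTop_of_neg (neg_neg_of_pos hπ)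
    rw [zero_add] at ht
    refine le_of_tendsto ht ?_
    filter_upwards [Filter.eventually_ge_atTop x] with y hy
    exact hm h (h.trans hy) hy

theorem abs_zwegersE_le (x : ℝ) : |zwegersE x| ≤ 1 := by
  refine abs_le.2 ⟨?_, zwegersE_le_one x⟩
  have := zwegersE_le_one (-x)
  rw [zwegersE_neg] at this
  linarith

/-- The coefficients `sign(n + 1/2) - E((n + p) c)`. -/
noncomputable def errCoeff (c p : ℝ) (n : ℤ) : ℝ :=
  Real.sign ((n : ℝ) + 1 / 2) - zwegersE (((n : ℝ) + p) * c)

/-- If n + 1/2 and n + p have compatible signs, the Gaussian tail bound applies. Otherwise n + p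
lies between 0 and p, the trivial bound 2 is used, and the factor e^{π(pc)²} compensates for the
Gaussian. -/
theorem abs_errCoeff_le {c : ℝ} (hc : 0 < c) (p : ℝ) (n : ℤ) :
    |errCoeff c p n| ≤ 2 * Real.exp (Real.pi * (p * c) ^ 2) *
      Real.exp (-Real.pi * ((n + p) * c) ^ 2) := by
  have hπ := Real.pi_pos
  have h1 : 1 ≤ Real.exp (Real.pi * (p * c) ^ 2) := Real.one_le_exp (by positivity)
  set x := ((n : ℝ) + p) * c with hx
  have hE := Real.exp_pos (-Real.pi * x ^ 2)
  have small : ∀ y : ℝ, |y| ≤ Real.exp (-Real.pi * x ^ 2) → |y| ≤ 2 * Real.exp (Real.pi * (p * c) ^ 2) *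
      Real.exp (-Real.pi * x ^ 2) := fun y hy => hy.trans (by nlinarith)
  have big : ∀ y : ℝ, |y| ≤ 2 → |(n : ℝ) + p| ≤ |p| → |y| ≤ 2 * Real.exp (Real.pi * (p * c) ^ 2) *
      Real.exp (-Real.pi * x ^ 2) := fun y hy hnp => by
    rw [mul_assoc, ← Real.exp_add]
    have : x ^ 2 ≤ (p * c) ^ 2 := by
      rw [hx, mul_pow, mul_pow]
      exact mul_le_mul_of_nonneg_right (sq_le_sq.2 hnp) (sq_nonneg c)
    have : 1 ≤ Real.exp (Real.pi * (p * c) ^ 2 + -Real.pi * x ^ 2) :=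
      Real.one_le_exp (by nlinarith)
    linarith
  have hle2 : ∀ s : ℝ, |s| = 1 → |s - zwegersE x| ≤ 2 := fun s hs =>
    (abs_sub _ _).trans (by linarith [abs_zwegersE_le x])
  unfold errCoeff
  rw [← hx]
  rcases le_or_gt 0 n with hn | hn
  · have hn' : (0 : ℝ) ≤ n := by exact_mod_cast hn
    rw [Real.sign_of_pos (by linarith)]
    rcases le_or_gt 0 ((n : ℝ) + p) with h | h
    · refine small _ ?_
      rw [abs_of_nonneg (by linarith [zwegersE_le_one x])]
      exact one_sub_zwegersE_le (by positivity)
    · refine big _ (hle2 1 abs_one) ?_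
      rw [abs_of_neg h, abs_of_neg (by linarith)]; linarith
  · have hn' : (n : ℝ) ≤ -1 := by exact_mod_cast (by omega : n ≤ -1)
    rw [Real.sign_of_neg (by linarith)]
    rcases le_or_gt ((n : ℝ) + p) 0 with h | h
    · refine small _ ?_
      have h2 := zwegersE_neg x
      have h3 := zwegersE_le_one (-x)
      have h4 := one_sub_zwegersE_le (x := -x) (by rw [hx]; nlinarith)
      rw [neg_sq] at h4
      rw [abs_of_nonpos (by linarith)]
      linarith
    · refine big _ (hle2 (-1) (by norm_num)) ?_
      rw [abs_of_pos h, abs_of_pos (by linarith)]; linarith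

/-! ### Gaussian sums -/

theorem summable_exp_neg_quadratic {T : ℝ} (hT : 0 < T) (S : ℝ) :
    Summable fun n : ℤ => Real.exp (-Real.pi * (T * n ^ 2 - 2 * S * |(n : ℝ)|)) := by
  simpa using summable_pow_mul_jacobiTheta₂_term_bound S hT 0

theorem exp_quadratic_le {T S : ℝ} {s : ℝ} (hs : |s| ≤ S) (n : ℤ) :
    Real.exp (-Real.pi * (T * n ^ 2 + 2 * s * n)) ≤
      Real.exp (-Real.pi * (T * n ^ 2 - 2 * S * |(n : ℝ)|)) := by
  have h1 : -(s * n) ≤ S * |(n : ℝ)| := (neg_le_abs _).trans (by rw [abs_mul]; gcongr)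
  refine Real.exp_le_exp.2 ?_
  nlinarith [Real.pi_pos]

theorem summable_exp_quadratic {T : ℝ} (hT : 0 < T) (s : ℝ) :
    Summable fun n : ℤ => Real.exp (-Real.pi * (T * n ^ 2 + 2 * s * n)) :=
  (summable_exp_neg_quadratic hT |s|).of_nonneg_of_le (fun _ => (Real.exp_pos _).le)
    fun n => exp_quadratic_le le_rfl n

theorem norm_ex_neg_int_mul (n : ℤ) (w : ℂ) :
    ‖ex (-(n * w))‖ = Real.exp (2 * Real.pi * n * w.im) := by
  rw [norm_ex]; congr 1; simp; ring

theorem summable_errCoeff {c : ℝ} (hc : 0 < c) (p : ℝ) (w : ℂ) :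
    Summable fun n : ℤ => (errCoeff c p n : ℂ) * ex (-(n * w)) := by
  refine Summable.of_norm_bounded (g := fun n : ℤ => 2 *
    Real.exp (-Real.pi * (c ^ 2 * n ^ 2 + 2 * (c ^ 2 * p - w.im) * n)))
    ((summable_exp_quadratic (by positivity) _).mul_left 2) fun n => ?_
  rw [norm_mul, norm_ex_neg_int_mul, Complex.norm_real, Real.norm_eq_abs]
  refine (mul_le_mul_of_nonneg_right (abs_errCoeff_le hc p n) (Real.exp_pos _).le).trans ?_
  rw [mul_assoc, mul_assoc, ← Real.exp_add, ← Real.exp_add]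
  refine le_of_eq ?_
  congr 2; ring

/-- The summands of the periodized Gaussian kernel. -/
noncomputable def gaussTerm (c p : ℝ) (w : ℂ) (b : ℤ) : ℂ :=
  ex (p * (w + b)) * Complex.exp (-(Real.pi * (w + b) ^ 2 / c ^ 2))

theorem norm_gaussTerm (c p : ℝ) (w : ℂ) (b : ℤ) :
    ‖gaussTerm c p w b‖ = Real.exp (-(2 * Real.pi * p * w.im)) *
      Real.exp (-(Real.pi * (((w.re + b) ^ 2 - w.im ^ 2) / c ^ 2))) := by
  rw [gaussTerm, norm_mul, norm_ex, Complex.norm_exp]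
  have e : (-(Real.pi * (w + b) ^ 2 / c ^ 2) : ℂ) = ((-(Real.pi / c ^ 2) : ℝ) : ℂ) * (w + b) ^ 2 := by
    push_cast; ring
  have e2 : ((w + b) ^ 2).re = (w.re + b) ^ 2 - w.im ^ 2 := by
    simp [sq, Complex.mul_re]
  rw [e, Complex.re_ofReal_mul, e2]
  congr 1
  · congr 1; simp; ring
  · congr 1; ring

theorem summable_gauss_real {c : ℝ} (hc : 0 < c) (x y : ℝ) :
    Summable fun b : ℤ => Real.exp (-(Real.pi * (((x + b) ^ 2 - y ^ 2) / c ^ 2))) := by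
  have h := (summable_exp_quadratic (T := 1 / c ^ 2) (by positivity) (x / c ^ 2)).mul_left
    (Real.exp (-(Real.pi * ((x ^ 2 - y ^ 2) / c ^ 2))))
  refine h.congr fun b => ?_
  rw [← Real.exp_add]
  congr 1
  field_simp
  ring

theorem summable_gaussTerm {c : ℝ} (hc : 0 < c) (p : ℝ) (w : ℂ) :
    Summable (gaussTerm c p w) := by
  refine Summable.of_norm ?_
  simp only [norm_gaussTerm]
  exact (summable_gauss_real hc _ _).mul_left _

theorem summable_gaussTerm_div {c : ℝ} (hc : 0 < c) (p : ℝ) (w : ℂ) :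
    Summable fun b : ℤ => gaussTerm c p w b / (w + b) := by
  refine Summable.of_norm_bounded_eventually (summable_gaussTerm hc p w).norm ?_
  have hfin : {b : ℤ | ¬ ‖gaussTerm c p w b / (w + b)‖ ≤ ‖gaussTerm c p w b‖}.Finite := by
    refine (Set.finite_Icc (-⌈|w.re| + 1⌉) ⌈|w.re| + 1⌉).subset fun b hb => ?_
    by_contra hcon
    refine hb ?_
    rw [norm_div]
    refine div_le_self (norm_nonneg _) ?_
    have h1 : (⌈|w.re| + 1⌉ : ℝ) < |(b : ℝ)| := by
      rw [Set.mem_Icc, ← abs_le, not_le] at hcon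
      exact_mod_cast hcon
    have h2 := Int.le_ceil (|w.re| + 1)
    have h3 : |(w + b).re| ≤ ‖w + b‖ := Complex.abs_re_le_norm _
    have h4 : |(b : ℝ)| ≤ |(w + b).re| + |w.re| := by
      have := abs_sub (w + b).re w.re
      simpa using this
    linarith
  exact hfin

/-! ### The partial fraction expansion of the Gaussian kernel -/

/-- Poisson summation for a Gaussian. The two sides are, up to constants, the p-derivatives of the
two series in `partial_fraction_gauss`. -/
theorem tsum_exp_errDeriv {c : ℝ} (hc : 0 < c) (p : ℝ) (w : ℂ) :
    ∑' n : ℤ, (c : ℂ) * Complex.exp (-(Real.pi * ((n + p) * c) ^ 2)) * ex (-(n * w)) =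
      ∑' b : ℤ, gaussTerm c p w b := by
  have hc0 : (c : ℂ) ≠ 0 := by exact_mod_cast hc.ne'
  have h := Complex.tsum_exp_neg_quadratic (a := (c : ℂ) ^ 2)
    (by rw [← Complex.ofReal_pow, Complex.ofReal_re]; positivity) (-(c ^ 2 * p) - Complex.I * w)
  have hs : ((c : ℂ) ^ 2) ^ (1 / 2 : ℂ) = c := by
    rw [← Complex.ofReal_pow, show (1 / 2 : ℂ) = ((1 / 2 : ℝ) : ℂ) by norm_num,
      ← Complex.ofReal_cpow (by positivity), ← Real.sqrt_eq_rpow, Real.sqrt_sq hc.le]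
  rw [hs] at h
  have e1 : ∀ n : ℤ, (c : ℂ) * Complex.exp (-(Real.pi * ((n + p) * c) ^ 2)) * ex (-(n * w)) =
      (c * Complex.exp (-(Real.pi * (p * c) ^ 2))) * Complex.exp (-Real.pi * c ^ 2 * n ^ 2
        + 2 * Real.pi * (-(c ^ 2 * p) - Complex.I * w) * n) := fun n => by
    rw [ex, mul_assoc, mul_assoc (c : ℂ), ← Complex.exp_add, ← Complex.exp_add]
    congr 2; ring
  simp only [e1]
  rw [tsum_mul_left, h, ← mul_assoc, ← tsum_mul_left]
  refine tsum_congr fun b => ?_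
  rw [gaussTerm, ex, mul_one_div, mul_comm (c : ℂ), mul_div_assoc, div_self hc0, mul_one,
    ← Complex.exp_add, ← Complex.exp_add]
  congr 1
  rw [show (b : ℂ) + Complex.I * (-(c ^ 2 * p) - Complex.I * w) = b + w - Complex.I * (c ^ 2 * p) by
    linear_combination -w * Complex.I_sq]
  field_simp
  linear_combination (-((c : ℂ) ^ 2 * p) ^ 2) * Complex.I_sq

theorem hasDerivAt_errCoeff (c p : ℝ) (n : ℤ) :
    HasDerivAt (fun p => errCoeff c p n)
      (-(2 * (c * Real.exp (-Real.pi * ((n + p) * c) ^ 2)))) p := by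
  have h1 : HasDerivAt (fun p : ℝ => ((n : ℝ) + p) * c) (1 * c) p :=
    ((hasDerivAt_id p).const_add (n : ℝ)).mul_const c
  refine (((hasDerivAt_zwegersE _).comp p h1).const_sub (Real.sign ((n : ℝ) + 1 / 2))).congr_deriv ?_
  ring

theorem hasDerivAt_tsum_errCoeff {c : ℝ} (hc : 0 < c) (p : ℝ) (w : ℂ) :
    HasDerivAt (fun p : ℝ => ∑' n : ℤ, (errCoeff c p n : ℂ) * ex (-(n * w)))
      (-2 * ∑' b : ℤ, gaussTerm c p w b) p := by
  have hπ := Real.pi_pos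
  set R := |p| + 1
  have hR : 0 ≤ R := by positivity
  have hu : Summable fun n : ℤ => 2 * c *
      Real.exp (-Real.pi * (c ^ 2 * n ^ 2 - 2 * (c ^ 2 * R + |w.im|) * |(n : ℝ)|)) :=
    (summable_exp_neg_quadratic (by positivity) _).mul_left _
  have h := hasDerivAt_tsum_of_isPreconnected (t := Set.Ioo (-R) R) (y₀ := p) (y := p)
    (g := fun (n : ℤ) (p : ℝ) => (errCoeff c p n : ℂ) * ex (-(n * w)))
    (g' := fun (n : ℤ) (p : ℝ) =>
      -2 * ((c : ℂ) * Complex.exp (-(Real.pi * ((n + p) * c) ^ 2)) * ex (-(n * w))))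
    hu isOpen_Ioo isPreconnected_Ioo ?_ ?_ ?_ (summable_errCoeff hc p w) ?_
  · rwa [tsum_mul_left, tsum_exp_errDeriv hc] at h
  · intro n y _
    refine ((hasDerivAt_errCoeff c y n).ofReal_comp.mul_const _).congr_deriv ?_
    push_cast
    ring_nf
  · intro n y hy
    have hy' : |y| ≤ R := abs_le.2 ⟨hy.1.le, hy.2.le⟩
    rw [norm_mul, norm_mul, norm_mul, norm_ex_neg_int_mul, Complex.norm_real, Real.norm_eq_abs,
      abs_of_pos hc, norm_neg, Complex.norm_two,
      show (-(Real.pi * (((n : ℂ) + y) * c) ^ 2)) = ((-Real.pi * (((n : ℝ) + y) * c) ^ 2 : ℝ) : ℂ) by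
        push_cast; ring, ← Complex.ofReal_exp, Complex.norm_real, Real.norm_eq_abs, Real.abs_exp]
    rw [mul_assoc c, ← Real.exp_add, ← mul_assoc]
    refine mul_le_mul_of_nonneg_left ?_ (by positivity)
    have hs : |c ^ 2 * y - w.im| ≤ c ^ 2 * R + |w.im| := by
      refine (abs_sub _ _).trans ?_
      rw [abs_mul, abs_of_nonneg (sq_nonneg c)]
      gcongr
    refine le_trans ?_ (exp_quadratic_le hs n)
    refine Real.exp_le_exp.2 ?_
    nlinarith [sq_nonneg (y * c)]
  all_goals
    exact ⟨by have := neg_abs_le p; simp only [R]; linarith,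
      by have := le_abs_self p; simp only [R]; linarith⟩

/-- Differentiation in p brings down 2πi(w + b), which cancels the denominator. -/
theorem hasDerivAt_tsum_gaussTerm {c : ℝ} (hc : 0 < c) (p : ℝ) {w : ℂ} (hw : ∀ n : ℤ, w ≠ n) :
    HasDerivAt (fun p : ℝ => ∑' b : ℤ, gaussTerm c p w b / (w + b))
      (2 * Real.pi * Complex.I * ∑' b : ℤ, gaussTerm c p w b) p := by
  have hπ := Real.pi_pos
  set R := |p| + 1
  have hR : 0 ≤ R := by positivity
  have hu : Summable fun b : ℤ => 2 * Real.pi * (Real.exp (2 * Real.pi * R * |w.im|) *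
      Real.exp (-(Real.pi * (((w.re + b) ^ 2 - w.im ^ 2) / c ^ 2)))) :=
    ((summable_gauss_real hc _ _).mul_left _).mul_left _
  have h := hasDerivAt_tsum_of_isPreconnected (t := Set.Ioo (-R) R) (y₀ := p) (y := p)
    (g := fun (b : ℤ) (p : ℝ) => gaussTerm c p w b / (w + b))
    (g' := fun (b : ℤ) (p : ℝ) => 2 * Real.pi * Complex.I * gaussTerm c p w b)
    hu isOpen_Ioo isPreconnected_Ioo ?_ ?_ ?_ (summable_gaussTerm_div hc p w) ?_
  · rwa [tsum_mul_left] at h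
  · intro b y _
    have hwb : w + b ≠ 0 := fun h0 => hw (-b) (by push_cast; linear_combination h0)
    have h1 : HasDerivAt (fun p : ℝ => 2 * Real.pi * Complex.I * ((p : ℂ) * (w + b)))
        (2 * Real.pi * Complex.I * (1 * (w + b))) y :=
      (((hasDerivAt_id y).ofReal_comp).mul_const _).const_mul _
    have h2 := ((h1.cexp).mul_const (Complex.exp (-(Real.pi * (w + b) ^ 2 / c ^ 2)))).div_const (w + b)
    refine h2.congr_deriv ?_
    rw [gaussTerm, ex]
    field_simp
  · intro b y hy
    have hy' : |y| ≤ R := abs_le.2 ⟨hy.1.le, hy.2.le⟩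
    rw [norm_mul, norm_gaussTerm]
    have e : ‖(2 * Real.pi * Complex.I : ℂ)‖ = 2 * Real.pi := by
      simp [abs_of_pos hπ]
    rw [e]
    gcongr
    have h3 : -(y * w.im) ≤ R * |w.im| := (neg_le_abs _).trans (by rw [abs_mul]; gcongr)
    nlinarith
  all_goals
    exact ⟨by have := neg_abs_le p; simp only [R]; linarith,
      by have := le_abs_self p; simp only [R]; linarith⟩

/-- Reindexing n by one absorbs the shift of p inside E; the sign changes only at n = 0, by a jump
of 2. -/
theorem tsum_errCoeff_add_one {c : ℝ} (hc : 0 < c) (p : ℝ) (w : ℂ) :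
    ∑' n : ℤ, (errCoeff c (p + 1) n : ℂ) * ex (-(n * w)) =
      ex w * (∑' n : ℤ, (errCoeff c p n : ℂ) * ex (-(n * w)) - 2) := by
  have h1 : ∀ n : ℤ, (errCoeff c (p + 1) (n - 1) : ℂ) = errCoeff c p n - if n = 0 then 2 else 0 := by
    intro n
    have e : (((n - 1 : ℤ) : ℝ) + (p + 1)) * c = ((n : ℝ) + p) * c := by push_cast; ring
    rw [errCoeff, errCoeff, e]
    rcases lt_trichotomy n 0 with h | rfl | h
    · have h' : (n : ℝ) ≤ -1 := by exact_mod_cast (by omega : n ≤ -1)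
      rw [if_neg h.ne, Real.sign_of_neg (by push_cast; linarith), Real.sign_of_neg (by linarith)]
      simp
    · rw [if_pos rfl, Real.sign_of_neg (by push_cast; norm_num),
        Real.sign_of_pos (by push_cast; norm_num)]
      push_cast; ring
    · have h' : (1 : ℝ) ≤ n := by exact_mod_cast h
      rw [if_neg h.ne', Real.sign_of_pos (by push_cast; linarith), Real.sign_of_pos (by linarith)]
      simp
  have hs : Summable fun n : ℤ => (if n = 0 then (2 : ℂ) else 0) * ex (-(n * w)) :=
    summable_of_hasFiniteSupport ((Set.finite_singleton (0 : ℤ)).subset fun n hn => by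
      by_contra h
      exact hn (by simp [show n ≠ 0 from h]))
  have h2 : ∑' n : ℤ, (if n = 0 then (2 : ℂ) else 0) * ex (-(n * w)) = 2 := by
    rw [tsum_eq_single 0 (fun n hn => by simp [hn])]
    simp [ex_zero]
  rw [← (Equiv.subRight (1 : ℤ)).tsum_eq, ← h2, ← (summable_errCoeff hc p w).tsum_sub hs,
    ← tsum_mul_left]
  refine tsum_congr fun n => ?_
  rw [Equiv.subRight_apply, h1, ← sub_mul, mul_left_comm, ← ex_add]
  congr 2
  push_cast; ring

theorem tsum_gaussTerm_add_one (c p : ℝ) (w : ℂ) :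
    ∑' b : ℤ, gaussTerm c (p + 1) w b / (w + b) =
      ex w * ∑' b : ℤ, gaussTerm c p w b / (w + b) := by
  rw [← tsum_mul_left]
  refine tsum_congr fun b => ?_
  rw [gaussTerm, gaussTerm, ← mul_div_assoc, ← mul_assoc, ← ex_add]
  congr 2
  exact ex_eq_of_sub_int b (by push_cast; ring)

/-- By Poisson summation the difference of the two series is independent of p. The shift p ↦ p + 1
multiplies both by e^{2πiw}, apart from the jump of the sign; invariance under this shift is a
linear equation that determines the constant. -/
theorem partial_fraction_gauss {c : ℝ} (hc : 0 < c) (p : ℝ) {w : ℂ} (hw : ∀ n : ℤ, w ≠ n) :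
    1 / (1 - ex w) + 1 / 2 * ∑' n : ℤ, (errCoeff c p n : ℂ) * ex (-(n * w)) =
      1 + Complex.I / (2 * Real.pi) * ∑' b : ℤ, gaussTerm c p w b / (w + b) := by
  have hπ : (Real.pi : ℂ) ≠ 0 := by exact_mod_cast Real.pi_ne_zero
  have hw1 : 1 - ex w ≠ 0 := by
    rw [sub_ne_zero, ne_comm, Ne, ex_eq_one_iff]
    rintro ⟨n, h⟩
    exact hw n h
  let D : ℝ → ℂ := fun p => 1 / 2 * ∑' n : ℤ, (errCoeff c p n : ℂ) * ex (-(n * w)) -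
    Complex.I / (2 * Real.pi) * ∑' b : ℤ, gaussTerm c p w b / (w + b)
  have hD : ∀ p, HasDerivAt D 0 p := fun p => by
    refine (((hasDerivAt_tsum_errCoeff hc p w).const_mul (1 / 2)).sub
      ((hasDerivAt_tsum_gaussTerm hc p hw).const_mul (Complex.I / (2 * Real.pi)))).congr_deriv ?_
    field_simp
    linear_combination (-∑' b : ℤ, gaussTerm c p w b) * Complex.I_sq
  have hconst : D (p + 1) = D p :=
    is_const_of_deriv_eq_zero (fun p => (hD p).differentiableAt) (fun p => (hD p).deriv) _ _
  simp only [D] at hconst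
  rw [tsum_errCoeff_add_one hc, tsum_gaussTerm_add_one] at hconst
  set A := ∑' n : ℤ, (errCoeff c p n : ℂ) * ex (-(n * w))
  set B := Complex.I / (2 * Real.pi) * ∑' b : ℤ, gaussTerm c p w b / (w + b) with hB
  rw [mul_left_comm (Complex.I / (2 * Real.pi)), ← hB] at hconst
  rw [← sub_eq_zero]
  -- This is D(p + 1) = D(p), that is (1 - e^{2πiw})(A/2 - B) = -e^{2πiw}.
  have h3 : (1 - ex w) * (1 / (1 - ex w) + 1 / 2 * A - (1 + B)) = 0 := by
    rw [mul_sub, mul_add, mul_one_div_cancel hw1]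
    linear_combination -hconst
  exact (mul_eq_zero.1 h3).resolve_left hw1

/-! ### Gaussian sums over lattices -/

theorem norm_sq_lattice_ge {τ : ℂ} (hτ : 0 < τ.im) :
    ∃ δ > 0, ∀ (z : ℂ) (l b : ℤ), δ * (l : ℝ) ^ 2 + δ * (b : ℝ) ^ 2 - ‖z‖ ^ 2 ≤ ‖z + l * τ + b‖ ^ 2 := by
  let r := EisensteinSeries.r ⟨τ, hτ⟩
  have hr : 0 < r := EisensteinSeries.r_pos _
  -- One factor 2 comes from l² + b² ≤ 2 max², the other from (x + y)² ≤ 2x² + 2y².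
  refine ⟨r ^ 2 / 4, by positivity, fun z l b => ?_⟩
  have h1 : r * max |(l : ℝ)| |(b : ℝ)| ≤ ‖(l : ℂ) * τ + b‖ := by
    by_cases h : (![l, b] : Fin 2 → ℤ) = 0
    · have hl : l = 0 := congrFun h 0
      have hb : b = 0 := congrFun h 1
      simp [hl, hb]
    · have := EisensteinSeries.r_mul_max_le ⟨τ, hτ⟩ h
      simpa [EisensteinSeries.norm_eq_max_natAbs, Nat.cast_natAbs] using this
  have h2 : ‖(l : ℂ) * τ + b‖ ≤ ‖z + l * τ + b‖ + ‖z‖ := by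
    have := norm_sub_le (z + l * τ + b) z
    rwa [show z + l * τ + b - z = (l : ℂ) * τ + b by ring] at this
  have h3 : (l : ℝ) ^ 2 ≤ max |(l : ℝ)| |(b : ℝ)| ^ 2 := by
    rw [← sq_abs]; gcongr; exact le_max_left _ _
  have h4 : (b : ℝ) ^ 2 ≤ max |(l : ℝ)| |(b : ℝ)| ^ 2 := by
    rw [← sq_abs]; gcongr; exact le_max_right _ _
  have h5 : 0 ≤ max |(l : ℝ)| |(b : ℝ)| := (abs_nonneg _).trans (le_max_left _ _)
  have h6 : (r * max |(l : ℝ)| |(b : ℝ)|) ^ 2 ≤ (‖z + l * τ + b‖ + ‖z‖) ^ 2 := by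
    gcongr; exact h1.trans h2
  have hr2 : 0 < r ^ 2 := by positivity
  nlinarith [sq_nonneg (‖z + l * τ + b‖ - ‖z‖)]

theorem summable_lattice_gauss {a : ℝ} (ha : 0 < a) {τ : ℂ} (hτ : 0 < τ.im) (z : ℂ) :
    Summable fun x : ℤ × ℤ => Real.exp (-(Real.pi * a * ‖z + x.1 * τ + x.2‖ ^ 2)) := by
  obtain ⟨δ, hδ, h⟩ := norm_sq_lattice_ge hτ
  have h1 : Summable fun n : ℤ => Real.exp (-Real.pi * (a * δ * (n : ℝ) ^ 2 + 2 * 0 * n)) :=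
    summable_exp_quadratic (by positivity) 0
  have h2 := (h1.mul_of_nonneg h1 (fun _ => (Real.exp_pos _).le)
    (fun _ => (Real.exp_pos _).le)).mul_left (Real.exp (Real.pi * a * ‖z‖ ^ 2))
  refine h2.of_nonneg_of_le (fun _ => (Real.exp_pos _).le) fun x => ?_
  rw [← Real.exp_add, ← Real.exp_add]
  refine Real.exp_le_exp.2 ?_
  have h3 := mul_le_mul_of_nonneg_left (h z x.1 x.2) (mul_pos Real.pi_pos ha).le
  linarith

/-- The Gaussian kernel `e^{-πa|Z|²}/Z`. -/
noncomputable def gaussKernel (a : ℝ) (Z : ℂ) : ℂ := (Real.exp (-(Real.pi * a * ‖Z‖ ^ 2)) : ℝ) / Z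

theorem gaussKernel_neg (a : ℝ) (Z : ℂ) : gaussKernel a (-Z) = -gaussKernel a Z := by
  rw [gaussKernel, gaussKernel, norm_neg, div_neg]

/-- All but finitely many lattice translates satisfy |Z| > 1, and there the kernel is dominated by
the Gaussian. -/
theorem summable_gaussKernel {a : ℝ} (ha : 0 < a) {τ : ℂ} (hτ : 0 < τ.im) (z : ℂ) :
    Summable fun x : ℤ × ℤ => ‖gaussKernel a (z + x.1 * τ + x.2)‖ := by
  have hs := summable_lattice_gauss ha hτ z
  refine Summable.of_norm_bounded_eventually hs ?_
  have h := hs.tendsto_cofinite_zero.eventually_lt_const (Real.exp_pos (-(Real.pi * a)))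
  filter_upwards [h] with x hx
  rw [norm_norm, gaussKernel, norm_div, Complex.norm_real, Real.norm_eq_abs, Real.abs_exp]
  refine div_le_self (Real.exp_pos _).le ?_
  rw [Real.exp_lt_exp, neg_lt_neg_iff] at hx
  have : 1 < ‖z + x.1 * τ + x.2‖ ^ 2 := by
    have h1 := mul_pos Real.pi_pos ha
    by_contra hcon
    nlinarith
  nlinarith [norm_nonneg (z + x.1 * τ + x.2)]

theorem norm_ex_ofReal (x : ℝ) : ‖ex x‖ = 1 := by
  rw [norm_ex]; simp

/-- The sum `∑_{l,b} e^{2πik(lq - bp)} e^{-πk|Z|²/Im τ}/Z` with `Z = z + lτ + b`. -/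
noncomputable def latticeSum (k : ℕ) (τ z : ℂ) (p q : ℝ) : ℂ :=
  ∑' x : ℤ × ℤ, ex ((k * (x.1 * q - x.2 * p) : ℝ)) * gaussKernel (k / τ.im) (z + x.1 * τ + x.2)

theorem summable_latticeSum {k : ℕ} (hk : 0 < k) {τ : ℂ} (hτ : 0 < τ.im) (z : ℂ) (p q : ℝ) :
    Summable fun x : ℤ × ℤ => ex ((k * (x.1 * q - x.2 * p) : ℝ)) *
      gaussKernel (k / τ.im) (z + x.1 * τ + x.2) := by
  refine Summable.of_norm ?_
  simp only [norm_mul, norm_ex_ofReal, one_mul]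
  have : (0 : ℝ) < k := by exact_mod_cast hk
  exact summable_gaussKernel (by positivity) hτ z

theorem latticeSum_neg (k : ℕ) (τ z : ℂ) (p q : ℝ) :
    latticeSum k τ (-z) (-p) (-q) = -latticeSum k τ z p q := by
  rw [latticeSum, latticeSum, ← tsum_neg, ← (Equiv.neg (ℤ × ℤ)).tsum_eq]
  refine tsum_congr fun x => ?_
  simp only [Equiv.neg_apply, Prod.fst_neg, Prod.snd_neg]
  rw [← mul_neg, ← gaussKernel_neg]
  congr 2
  · push_cast; ring
  · push_cast; ring

/-! ### The products of `R` and theta functions as double series -/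

theorem tsum_int_eq_sum_range {N : ℕ} (hN : 0 < N) {g : ℤ → ℂ} (hg : Summable g) :
    ∑ j ∈ Finset.range N, ∑' a : ℤ, g (j + N * a) = ∑' n : ℤ, g n := by
  have : NeZero N := ⟨hN.ne'⟩
  have hs : Summable fun x : ℤ × Fin N => g ((Int.divModEquiv N).symm x) :=
    (Int.divModEquiv N).symm.summable_iff.2 hg
  have hN0 : (N : ℤ) ≠ 0 := by exact_mod_cast hN.ne'
  rw [← (Int.divModEquiv N).symm.tsum_eq, hs.tsum_prod, ← Summable.tsum_finsetSum]
  · refine tsum_congr fun a => ?_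
    rw [tsum_fintype, Finset.sum_range]
    refine Finset.sum_congr rfl fun j _ => ?_
    rw [Int.divModEquiv_symm_apply]
    congr 1
    simp; ring
  · intro j _
    refine hg.comp_injective fun a b h => ?_
    have h' : (j : ℤ) + N * a = j + N * b := h
    exact mul_left_cancel₀ hN0 (add_left_cancel h')

/-- The factor `e^{2πiklu} q^{kl²}`. -/
noncomputable def thetaFactor (k : ℕ) (τ u : ℂ) (l : ℤ) : ℂ :=
  ex (l * k * u + (l : ℂ) ^ 2 * k * τ)

theorem zwegersRTerm_eq (k : ℕ) (n : ℤ) (τ v : ℂ) :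
    zwegersRTerm k n τ v = errCoeff (Real.sqrt (τ.im / k)) (2 * k * (v.im / τ.im)) n *
      ex (-((n : ℂ) ^ 2 / (4 * k) * τ) - n * v) := by
  rw [zwegersRTerm, errCoeff, ex]
  congr 2
  ring

theorem norm_ex_quadratic (α β : ℂ) (n : ℤ) :
    ‖ex ((n : ℂ) ^ 2 * α + n * β)‖ =
      Real.exp (-Real.pi * (2 * α.im * (n : ℝ) ^ 2 + 2 * β.im * n)) := by
  rw [norm_ex]
  congr 1
  have : ((n : ℂ) ^ 2 * α + n * β).im = (n : ℝ) ^ 2 * α.im + n * β.im := by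
    rw [show (n : ℂ) ^ 2 * α + n * β = (((n : ℝ) ^ 2 : ℝ) : ℂ) * α + ((n : ℝ) : ℂ) * β by push_cast; rfl,
      Complex.add_im, Complex.im_ofReal_mul, Complex.im_ofReal_mul]
  rw [this]; ring

/-- The coefficient decays like e^{-πn² Im τ/k}, while the exponential grows like e^{πn² Im τ/(2k)}:
half of the decay remains. -/
theorem summable_norm_zwegersRTerm {k : ℕ} (hk : 0 < k) {τ : ℂ} (hτ : 0 < τ.im) (v : ℂ) :
    Summable fun n : ℤ => ‖zwegersRTerm k n τ v‖ := by
  have hk' : (0 : ℝ) < k := by exact_mod_cast hk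
  have hc : 0 < Real.sqrt (τ.im / k) := Real.sqrt_pos.2 (by positivity)
  have hc2 : Real.sqrt (τ.im / k) ^ 2 = τ.im / k := Real.sq_sqrt (by positivity)
  set c := Real.sqrt (τ.im / k)
  set p := 2 * k * (v.im / τ.im)
  have h := (summable_exp_quadratic (T := τ.im / (2 * k)) (by positivity)
    (τ.im / k * p - v.im)).mul_left 2
  refine h.of_nonneg_of_le (fun _ => norm_nonneg _) fun n => ?_
  rw [zwegersRTerm_eq, norm_mul, Complex.norm_real, Real.norm_eq_abs]
  have e : -((n : ℂ) ^ 2 / (4 * k) * τ) - n * v =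
      (n : ℂ) ^ 2 * (((-1 / (4 * k) : ℝ) : ℂ) * τ) + n * (-v) := by
    push_cast; field_simp; ring
  rw [e, norm_ex_quadratic, Complex.im_ofReal_mul, Complex.neg_im]
  refine (mul_le_mul_of_nonneg_right (abs_errCoeff_le hc p n) (Real.exp_pos _).le).trans ?_
  rw [mul_assoc, mul_assoc, ← Real.exp_add, ← Real.exp_add]
  refine le_of_eq ?_
  congr 2
  simp only [p, mul_pow, hc2]
  field_simp
  ring

theorem summable_thetaFactor {k : ℕ} (hk : 0 < k) {τ : ℂ} (hτ : 0 < τ.im) (u : ℂ) :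
    Summable (thetaFactor k τ u) := by
  have hk' : (0 : ℝ) < k := by exact_mod_cast hk
  refine Summable.of_norm ?_
  refine (summable_exp_quadratic (T := 2 * (k * τ.im)) (by positivity) (k * u.im)).congr fun l => ?_
  rw [thetaFactor, show (l : ℂ) * k * u + (l : ℂ) ^ 2 * k * τ =
    (l : ℂ) ^ 2 * (((k : ℝ) : ℂ) * τ) + l * (((k : ℝ) : ℂ) * u) by push_cast; ring, norm_ex_quadratic,
    Complex.im_ofReal_mul, Complex.im_ofReal_mul]

theorem tsum_thetaFactor_neg (k : ℕ) (τ u : ℂ) :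
    ∑' l : ℤ, thetaFactor k τ (-u) l = ∑' l : ℤ, thetaFactor k τ u l := by
  rw [← (Equiv.neg ℤ).tsum_eq]
  refine tsum_congr fun l => ?_
  rw [Equiv.neg_apply, thetaFactor, thetaFactor]
  congr 1
  push_cast; ring

/-- The terms of the double series of `∑_j R_j Θ_{-j}`. -/
noncomputable def mixedTerm (k : ℕ) (τ u v : ℂ) (n l : ℤ) : ℂ :=
  thetaFactor k τ u l * (errCoeff (Real.sqrt (τ.im / k)) (2 * k * (v.im / τ.im)) n *
    ex (-(n * (u / 2 + v + l * τ))))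

theorem mixedTerm_eq {k : ℕ} (hk : 0 < k) (τ u v : ℂ) (n l : ℤ) :
    mixedTerm k τ u v n l = zwegersRTerm k n τ v *
      ex (k * ((l : ℂ) - n / (2 * k)) ^ 2 * τ + k * ((l : ℂ) - n / (2 * k)) * u) := by
  have hk' : (k : ℂ) ≠ 0 := by exact_mod_cast hk.ne'
  rw [mixedTerm, thetaFactor, zwegersRTerm_eq, mul_left_comm, ← ex_add, mul_assoc (errCoeff _ _ _ : ℂ),
    ← ex_add]
  congr 2
  field_simp
  ring

theorem summable_mixedTerm {k : ℕ} (hk : 0 < k) {τ : ℂ} (hτ : 0 < τ.im) (u v : ℂ) :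
    Summable fun x : ℤ × ℤ => mixedTerm k τ u v x.1 x.2 := by
  have hk' : (0 : ℝ) < k := by exact_mod_cast hk
  have hkc : (k : ℂ) ≠ 0 := by exact_mod_cast hk.ne'
  have h1 := summable_norm_zwegersRTerm hk hτ v
  have h2 : Summable fun r : ℤ => ‖ex ((r : ℂ) ^ 2 * (((1 / (4 * k) : ℝ) : ℂ) * τ) + r * (u / 2))‖ := by
    simp only [norm_ex_quadratic]
    refine summable_exp_quadratic ?_ _
    rw [Complex.im_ofReal_mul]
    positivity
  have h3 := h1.mul_of_nonneg h2 (fun _ => norm_nonneg _) (fun _ => norm_nonneg _)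
  -- With r = 2kl - n the theta exponent k(l - n/(2k))² is r²/(4k), so the double series is part of
  -- a product of two absolutely convergent ones.
  have hinj : Function.Injective fun x : ℤ × ℤ => (x.1, 2 * k * x.2 - x.1) := by
    rintro ⟨n, l⟩ ⟨n', l'⟩ h
    simp only [Prod.mk.injEq] at h
    obtain ⟨rfl, h⟩ := h
    have : (2 * k : ℤ) ≠ 0 := by positivity
    have : l = l' := mul_left_cancel₀ this (by linarith)
    rw [this]
  refine Summable.of_norm ((h3.comp_injective hinj).congr fun x => ?_)
  simp only [Function.comp]
  rw [mixedTerm_eq hk, norm_mul]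
  congr 3
  push_cast
  field_simp
  ring

theorem Theta_neg (j : ℤ) (k : ℕ) (τ u : ℂ) : Theta j k τ u = Theta (-j) k τ (-u) := by
  rw [Theta, Theta, ← (Equiv.neg ℤ).tsum_eq]
  refine tsum_congr fun n => ?_
  rw [Equiv.neg_apply]
  congr 1
  push_cast
  ring

/-- Writing n = j + 2ka merges the residue j and the summation index of R into one n ∈ ℤ; the shift
of l by a adapts the theta index to n. Absolute convergence permits summing over n first, as the
partial fraction identity requires. -/
theorem sum_zwegersR_mul_Theta {k : ℕ} (hk : 0 < k) {τ : ℂ} (hτ : 0 < τ.im) (u v : ℂ) :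
    ∑ j ∈ Finset.range (2 * k), zwegersR k j τ v * Theta (-j) k τ u =
      ∑' l : ℤ, ∑' n : ℤ, mixedTerm k τ u v n l := by
  have hkc : (k : ℂ) ≠ 0 := by exact_mod_cast hk.ne'
  have hs := summable_mixedTerm hk hτ u v
  have h1 : ∀ j : ℤ, zwegersR k j τ v * Theta (-j) k τ u =
      ∑' a : ℤ, ∑' l : ℤ, mixedTerm k τ u v (j + (2 * k : ℕ) * a) l := by
    intro j
    rw [zwegersR, ← tsum_mul_right]
    refine tsum_congr fun a => ?_
    rw [Theta, ← tsum_mul_left, ← (Equiv.subRight a).tsum_eq]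
    refine tsum_congr fun l => ?_
    rw [mixedTerm_eq hk, Equiv.subRight_apply]
    push_cast
    congr 2
    field_simp
    ring
  have hp : Summable fun n : ℤ => ∑' l : ℤ, mixedTerm k τ u v n l := hs.prod
  calc _ = ∑ j ∈ Finset.range (2 * k), ∑' a : ℤ, ∑' l : ℤ,
        mixedTerm k τ u v ((j : ℤ) + (2 * k : ℕ) * a) l := Finset.sum_congr rfl fun j _ => h1 j
    _ = ∑' n : ℤ, ∑' l : ℤ, mixedTerm k τ u v n l := tsum_int_eq_sum_range (by omega) hp
    _ = _ := (Summable.tsum_comm (f := fun n l => mixedTerm k τ u v n l) hs).symm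

/-! ### The modified numerator as a lattice sum -/

/-- The real coordinate `p` of `z = pτ + q`. -/
noncomputable def coordP (τ z : ℂ) : ℝ := z.im / τ.im

/-- The real coordinate `q` of `z = pτ + q`. -/
noncomputable def coordQ (τ z : ℂ) : ℝ := z.re - z.im / τ.im * τ.re

theorem coord_eq {τ : ℂ} (hτ : 0 < τ.im) (z : ℂ) : (coordP τ z : ℂ) * τ + coordQ τ z = z :=
  (exists_real_coords hτ z).symm

theorem coord_unique {τ : ℂ} (hτ : 0 < τ.im) {z : ℂ} {p q : ℝ} (h : z = p * τ + q) :
    coordP τ z = p ∧ coordQ τ z = q := by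
  have h1 : coordP τ z = p := by rw [coordP, h]; simp [hτ.ne']
  refine ⟨h1, ?_⟩
  rw [coordQ, ← coordP, h1, h]; simp

theorem coord_neg (τ z : ℂ) : coordP τ (-z) = -coordP τ z ∧ coordQ τ (-z) = -coordQ τ z := by
  constructor
  · simp [coordP, neg_div]
  · simp [coordQ, neg_div]; ring

theorem ofReal_exp_eq_ex (x : ℝ) : ((Real.exp (-(Real.pi * x)) : ℝ) : ℂ) = ex (Complex.I / 2 * x) := by
  rw [ex, Complex.ofReal_exp]
  congr 1
  push_cast
  linear_combination (-(Real.pi : ℂ) * x) * Complex.I_sq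

theorem norm_sq_eq (Z : ℂ) : ((‖Z‖ ^ 2 : ℝ) : ℂ) = Z * (Z - 2 * Complex.I * Z.im) := by
  have h : (starRingEnd ℂ) Z = Z - 2 * Complex.I * Z.im := by
    apply Complex.ext
    · simp
    · simp; ring
  rw [← h, Complex.mul_conj, Complex.normSq_eq_norm_sq]

/-- Since |Z|² = Z(Z - 2i Im Z), the choices c² = Im τ/k and p = k Im(z₁ - z₂)/Im τ complete the
holomorphic Gaussian in Z to e^{-πk|Z|²/Im τ}. What remains is a unitary character of (l, b) and a
factor independent of (l, b). -/
theorem thetaFactor_mul_gaussTerm {k : ℕ} (hk : 0 < k) {τ : ℂ} (hτ : 0 < τ.im) (z₁ z₂ : ℂ) (l b : ℤ) :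
    thetaFactor k τ (z₁ + z₂) l * gaussTerm (Real.sqrt (τ.im / k))
        (2 * k * (((z₁ - z₂) / 2).im / τ.im)) (z₁ + l * τ) b / (z₁ + l * τ + b) =
      ex (-(k * z₁ * coordP τ z₂)) * (ex ((k * (l * coordQ τ z₂ - b * coordP τ z₂) : ℝ)) *
        gaussKernel (k / τ.im) (z₁ + l * τ + b)) := by
  have hy : (τ.im : ℂ) ≠ 0 := by exact_mod_cast hτ.ne'
  have hk0 : (k : ℂ) ≠ 0 := by exact_mod_cast hk.ne'
  have hc2 : ((Real.sqrt (τ.im / k) : ℝ) : ℂ) ^ 2 = τ.im / k := by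
    rw [← Complex.ofReal_pow, Real.sq_sqrt (by positivity)]; push_cast; rfl
  have hz2 := coord_eq hτ z₂
  have hp2 : (z₂.im : ℂ) = coordP τ z₂ * τ.im := by
    rw [coordP]; push_cast; field_simp
  have hv : (((((z₁ - z₂) / 2).im : ℝ)) : ℂ) = (z₁.im - coordP τ z₂ * τ.im) / 2 := by
    rw [← hp2, show (z₁ - z₂) / 2 = (((1 / 2 : ℝ)) : ℂ) * (z₁ - z₂) by push_cast; ring,
      Complex.im_ofReal_mul, Complex.sub_im]
    push_cast; ring
  set Z := z₁ + l * τ + b with hZ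
  have hZim : (Z.im : ℂ) = z₁.im + l * τ.im := by
    rw [hZ]; simp
  have hg : gaussKernel (k / τ.im) Z =
      ex (Complex.I / 2 * (k / τ.im * (Z * (Z - 2 * Complex.I * (z₁.im + l * τ.im))))) / Z := by
    rw [gaussKernel, mul_assoc, ofReal_exp_eq_ex]
    congr 3
    rw [Complex.ofReal_mul, norm_sq_eq, hZim]
    push_cast; rfl
  have hG : Complex.exp (-(Real.pi * Z ^ 2 / (Real.sqrt (τ.im / k) : ℝ) ^ 2)) =
      ex (Complex.I / 2 * (k / τ.im * Z ^ 2)) := by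
    rw [hc2, ex]
    congr 1
    field_simp
    linear_combination (-Z ^ 2) * Complex.I_sq
  rw [gaussTerm, ← hZ, hG, thetaFactor, hg]
  simp only [← mul_div_assoc, ← ex_add]
  congr 1
  -- The cross term -kbl is an integer and drops out of the exponential.
  refine ex_eq_of_sub_int (-(k * b * l)) ?_
  generalize hP : (coordP τ z₂ : ℝ) = P at *
  generalize hQ : (coordQ τ z₂ : ℝ) = Q at *
  push_cast
  rw [hv, ← hz2, hZ]
  field_simp
  linear_combination ((2 : ℂ) * (z₁ + l * τ + b) * (z₁.im + l * τ.im)) * Complex.I_sq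

/-- `partial_fraction_gauss` at w = z₁ + lτ, with c and p independent of l. Convergence of the
Appell–Lerch sum follows from that of the three series into which it decomposes. -/
theorem hasSum_appell {k : ℕ} (hk : 0 < k) {τ : ℂ} (hτ : 0 < τ.im) {z₁ z₂ : ℂ}
    (hz : ∀ a b : ℤ, z₁ ≠ a + b * τ) :
    HasSum (fun l : ℤ => thetaFactor k τ (z₁ + z₂) l / (1 - ex (z₁ + l * τ)))
      (∑' l : ℤ, thetaFactor k τ (z₁ + z₂) l
        + Complex.I / (2 * Real.pi) * (ex (-(k * z₁ * coordP τ z₂)) *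
            latticeSum k τ z₁ (coordP τ z₂) (coordQ τ z₂))
        - 1 / 2 * ∑' l : ℤ, ∑' n : ℤ, mixedTerm k τ (z₁ + z₂) ((z₁ - z₂) / 2) n l) := by
  have hk' : (0 : ℝ) < k := by exact_mod_cast hk
  have hc : 0 < Real.sqrt (τ.im / k) := Real.sqrt_pos.2 (by positivity)
  have h1 := (summable_thetaFactor hk hτ (z₁ + z₂)).hasSum
  have hs2 := summable_latticeSum hk hτ z₁ (coordP τ z₂) (coordQ τ z₂)
  have h2 := (hs2.prod.hasSum.mul_left (ex (-(k * z₁ * coordP τ z₂)))).mul_left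
    (Complex.I / (2 * Real.pi))
  rw [← hs2.tsum_prod] at h2
  have hs3 := (summable_mixedTerm hk hτ (z₁ + z₂) ((z₁ - z₂) / 2)).prod_symm
  have h3 := (hs3.prod.hasSum).mul_left (1 / 2)
  have hfun : (fun l : ℤ => thetaFactor k τ (z₁ + z₂) l / (1 - ex (z₁ + l * τ))) = fun l =>
      thetaFactor k τ (z₁ + z₂) l + Complex.I / (2 * Real.pi) * (ex (-(k * z₁ * coordP τ z₂)) *
        ∑' b : ℤ, ex ((k * (l * coordQ τ z₂ - b * coordP τ z₂) : ℝ)) *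
          gaussKernel (k / τ.im) (z₁ + l * τ + b))
      - 1 / 2 * ∑' n : ℤ, mixedTerm k τ (z₁ + z₂) ((z₁ - z₂) / 2) n l := by
    funext l
    have hw : ∀ n : ℤ, z₁ + l * τ ≠ n := fun n h =>
      hz n (-l) (by push_cast; linear_combination h)
    have h := partial_fraction_gauss hc (2 * k * (((z₁ - z₂) / 2).im / τ.im)) hw
    have e1 : ∑' n : ℤ, mixedTerm k τ (z₁ + z₂) ((z₁ - z₂) / 2) n l = thetaFactor k τ (z₁ + z₂) l *
        ∑' n : ℤ, (errCoeff (Real.sqrt (τ.im / k)) (2 * k * (((z₁ - z₂) / 2).im / τ.im)) n : ℂ) *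
          ex (-(n * (z₁ + l * τ))) := by
      rw [← tsum_mul_left]
      refine tsum_congr fun n => ?_
      rw [mixedTerm, show (z₁ + z₂) / 2 + (z₁ - z₂) / 2 + l * τ = z₁ + l * τ by ring]
    have e2 : ex (-(k * z₁ * coordP τ z₂)) *
        ∑' b : ℤ, ex ((k * (l * coordQ τ z₂ - b * coordP τ z₂) : ℝ)) *
          gaussKernel (k / τ.im) (z₁ + l * τ + b) = thetaFactor k τ (z₁ + z₂) l *
        ∑' b : ℤ, gaussTerm (Real.sqrt (τ.im / k)) (2 * k * (((z₁ - z₂) / 2).im / τ.im))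
          (z₁ + l * τ) b / (z₁ + l * τ + b) := by
      rw [← tsum_mul_left, ← tsum_mul_left]
      refine tsum_congr fun b => ?_
      rw [← thetaFactor_mul_gaussTerm hk hτ, mul_div_assoc]
    rw [e1, e2, div_eq_mul_one_div]
    linear_combination thetaFactor k τ (z₁ + z₂) l * h
  rw [hfun]
  exact (h1.add h2).sub h3

/-- The second half of Φ is the first at (-z₂, -z₁). The theta series are even in z₁ + z₂ and cancel
in the difference; by Θ_j(u) = Θ_{-j}(-u) the two mixed double series are exactly what the
correction term removes. -/
theorem PhiMod_eq (m : ℕ) {τ : ℂ} (hτ : 0 < τ.im) {z₁ z₂ : ℂ}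
    (h₁ : ∀ a b : ℤ, z₁ ≠ a + b * τ) (h₂ : ∀ a b : ℤ, z₂ ≠ a + b * τ) (t : ℂ) :
    PhiMod m τ z₁ z₂ t = Complex.I / (2 * Real.pi) * ex ((m + 1) * t) *
      (ex (-((m + 1) * z₁ * coordP τ z₂)) * latticeSum (m + 1) τ z₁ (coordP τ z₂) (coordQ τ z₂)
      + ex (-((m + 1) * z₂ * coordP τ z₁)) * latticeSum (m + 1) τ z₂ (coordP τ z₁) (coordQ τ z₁)) := by
  have hk : 0 < m + 1 := m.succ_pos
  have hA := hasSum_appell hk hτ (z₁ := z₁) (z₂ := z₂) h₁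
  have hB := hasSum_appell hk hτ (z₁ := -z₂) (z₂ := -z₁) fun a b h =>
    h₂ (-a) (-b) (by push_cast; linear_combination -h)
  rw [show -z₂ + -z₁ = -(z₁ + z₂) by ring, show (-z₂ - -z₁) / 2 = (z₁ - z₂) / 2 by ring,
    tsum_thetaFactor_neg, (coord_neg τ z₁).1, (coord_neg τ z₁).2, latticeSum_neg] at hB
  have hPhi : Phi m τ z₁ z₂ t = ex ((m + 1) * t) *
      ∑' l : ℤ, (thetaFactor (m + 1) τ (z₁ + z₂) l / (1 - ex (z₁ + l * τ))
        - thetaFactor (m + 1) τ (-(z₁ + z₂)) l / (1 - ex (-z₂ + l * τ))) := by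
    rw [Phi]
    congr 1
    refine tsum_congr fun l => ?_
    simp only [thetaFactor]
    push_cast
    congr 4
    ring
  have hR1 := sum_zwegersR_mul_Theta hk hτ (z₁ + z₂) ((z₁ - z₂) / 2)
  have hR2 := sum_zwegersR_mul_Theta hk hτ (-(z₁ + z₂)) ((z₁ - z₂) / 2)
  have hAdd : PhiAdd m τ z₁ z₂ t = -(1 / 2) * ex ((m + 1) * t) *
      (∑' l : ℤ, ∑' n : ℤ, mixedTerm (m + 1) τ (-(z₁ + z₂)) ((z₁ - z₂) / 2) n l
       - ∑' l : ℤ, ∑' n : ℤ, mixedTerm (m + 1) τ (z₁ + z₂) ((z₁ - z₂) / 2) n l) := by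
    rw [PhiAdd, ← hR1, ← hR2, ← Finset.sum_sub_distrib]
    congr 1
    refine Finset.sum_congr rfl fun j _ => ?_
    rw [Theta_neg j, mul_sub]
  rw [PhiMod, hPhi, hAdd, (hA.sub hB).tsum_eq]
  push_cast
  rw [show -(((m : ℂ) + 1) * -z₂ * -(coordP τ z₁ : ℂ)) = -((m + 1) * z₂ * coordP τ z₁) by ring]
  ring

/-! ### The modified functions `Ψ̃` as lattice sums -/

/-- The summand, at `(l, b) ∈ ℤ²`, of the lattice sum which represents half of `Ψ̃`. -/
noncomputable def sectorTerm (k M : ℕ) (ε j j' : ℚ) (τ z : ℂ) (p q : ℝ) (x : ℤ × ℤ) : ℂ :=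
  ex ((k / M * ((j + M * x.1) * q - (x.2 + ε) * (p + j') + M * x.1 * ε) : ℝ)) *
    gaussKernel (k / (M * τ.im)) (z + (j + M * x.1) * τ + (x.2 + ε))

/-- The lattice sum which represents half of `Ψ̃`. -/
noncomputable def sectorSum (k M : ℕ) (ε j j' : ℚ) (τ z : ℂ) (p q : ℝ) : ℂ :=
  ∑' x : ℤ × ℤ, sectorTerm k M ε j j' τ z p q x

theorem summable_sectorTerm {k M : ℕ} (hk : 0 < k) (hM : 0 < M) (ε j j' : ℚ) {τ : ℂ}
    (hτ : 0 < τ.im) (z : ℂ) (p q : ℝ) : Summable (sectorTerm k M ε j j' τ z p q) := by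
  have hk' : (0 : ℝ) < k := by exact_mod_cast hk
  have hM' : (0 : ℝ) < M := by exact_mod_cast hM
  have hMτ : 0 < ((M : ℂ) * τ).im := by
    rw [← Complex.ofReal_natCast, Complex.im_ofReal_mul]; positivity
  refine Summable.of_norm ((summable_gaussKernel (a := k / (M * τ.im)) (by positivity) hMτ
    (z + j * τ + ε)).congr fun x => ?_)
  rw [sectorTerm, norm_mul, norm_ex_ofReal, one_mul]
  congr 2
  ring

/-- The prefactor of Ψ̃ absorbs the exponentials produced by the shifts of z₁ and z₂, leaving j, j'
and ε only in a unitary phase and in the position of the lattice. -/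
theorem latticeSum_eq_sectorSum {k M : ℕ} (hM : 0 < M) (ε j j' : ℚ) {τ : ℂ}
    (hτ : 0 < τ.im) (z₁ z₂ t : ℂ) :
    ex (k * j * j' / M * τ) * ex (k / M * (j' * z₁ + j * z₂)) * (ex (k * (t / M)) *
      (ex (-(k * (z₁ + j * τ + ε) * coordP (M * τ) (z₂ + j' * τ + ε))) *
        latticeSum k (M * τ) (z₁ + j * τ + ε) (coordP (M * τ) (z₂ + j' * τ + ε))
          (coordQ (M * τ) (z₂ + j' * τ + ε)))) =
      ex (k / M * (t - z₁ * coordP τ z₂)) *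
        sectorSum k M ε j j' τ z₁ (coordP τ z₂) (coordQ τ z₂) := by
  have hM' : (0 : ℝ) < M := by exact_mod_cast hM
  have hMc : (M : ℂ) ≠ 0 := by exact_mod_cast hM.ne'
  have hMτ : ((M : ℂ) * τ).im = M * τ.im := by
    rw [← Complex.ofReal_natCast, Complex.im_ofReal_mul]
  have hz2 := coord_eq hτ z₂
  -- Real coordinates with respect to Mτ instead of τ.
  obtain ⟨hp, hq⟩ := coord_unique (τ := M * τ) (z := z₂ + j' * τ + ε) (by rw [hMτ]; positivity)
    (p := (coordP τ z₂ + j') / M) (q := coordQ τ z₂ + ε) (by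
      push_cast; field_simp; linear_combination -hz2)
  rw [hp, hq, latticeSum, sectorSum, hMτ]
  simp only [← tsum_mul_left]
  refine tsum_congr fun x => ?_
  rw [sectorTerm]
  simp only [← mul_assoc, ← ex_add]
  congr 1
  · generalize hP : (coordP τ z₂ : ℝ) = P at *
    generalize hQ : (coordQ τ z₂ : ℝ) = Q at *
    congr 1
    push_cast
    rw [← hz2]
    field_simp
    ring
  · congr 1
    ring

theorem PsiMod_eq {M : ℕ} (m : ℕ) (hM : 0 < M) (ε j j' : ℚ) {τ : ℂ} (hτ : 0 < τ.im) {z₁ z₂ : ℂ}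
    (h₁ : ∀ a b : ℤ, z₁ + j * τ + ε ≠ a + b * τ) (h₂ : ∀ a b : ℤ, z₂ + j' * τ + ε ≠ a + b * τ)
    (t : ℂ) :
    PsiMod M m ε j j' τ z₁ z₂ t = Complex.I / (2 * Real.pi) *
      (ex ((m + 1) / M * (t - z₁ * coordP τ z₂)) *
          sectorSum (m + 1) M ε j j' τ z₁ (coordP τ z₂) (coordQ τ z₂)
        + ex ((m + 1) / M * (t - z₂ * coordP τ z₁)) *
          sectorSum (m + 1) M ε j' j τ z₂ (coordP τ z₁) (coordQ τ z₁)) := by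
  have hMτ : 0 < ((M : ℂ) * τ).im := by
    rw [← Complex.ofReal_natCast, Complex.im_ofReal_mul]
    have hM' : (0 : ℝ) < M := by exact_mod_cast hM
    positivity
  have H1 := latticeSum_eq_sectorSum (k := m + 1) hM ε j j' hτ z₁ z₂ t
  have H2 := latticeSum_eq_sectorSum (k := m + 1) hM ε j' j hτ z₂ z₁ t
  push_cast at H1 H2
  rw [← H1, ← H2, PsiMod, PhiMod_eq m hMτ
    (fun a b h => h₁ a (b * M) (by rw [h]; push_cast; ring))
    (fun a b h => h₂ a (b * M) (by rw [h]; push_cast; ring)),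
    mul_right_comm ((m : ℂ) + 1) (j' : ℂ), add_comm ((j : ℂ) * z₂)]
  ring

/-! ### Transformation under `T` -/

theorem sectorSum_T {k M : ℕ} (hM : 0 < M) {ε ε'' j j' : ℚ} (n₁ n₂ : ℤ) (h₁ : j' + ε - ε'' = n₁)
    (h₂ : j + ε - ε'' = n₂) (τ z : ℂ) (p q : ℝ) :
    sectorSum k M ε j j' (τ + 1) z p (q - p) =
      ex (k * j * j' / M) * sectorSum k M ε'' j j' τ z p q := by
  have hMc : (M : ℂ) ≠ 0 := by exact_mod_cast hM.ne'
  have hj' : (j' : ℂ) = n₁ - ε + ε'' := by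
    have : j' = n₁ - ε + ε'' := by rw [← h₁]; ring
    rw [this]; push_cast; rfl
  have hj : (j : ℂ) = n₂ - ε + ε'' := by
    have : j = n₂ - ε + ε'' := by rw [← h₂]; ring
    rw [this]; push_cast; rfl
  -- The shear caused by (j + Ml)(τ + 1) = (j + Ml)τ + j + Ml; the offset n₂ absorbs the change from
  -- ε to ε''.
  let e : ℤ × ℤ ≃ ℤ × ℤ :=
    { toFun := fun x => (x.1, x.2 + M * x.1 + n₂)
      invFun := fun x => (x.1, x.2 - M * x.1 - n₂)
      left_inv := fun x => Prod.ext rfl (by dsimp only; ring)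
      right_inv := fun x => Prod.ext rfl (by dsimp only; ring) }
  rw [sectorSum, sectorSum, ← tsum_mul_left, ← e.tsum_eq (fun x => _ * sectorTerm _ _ _ _ _ _ _ _ _ x)]
  refine tsum_congr fun x => ?_
  have e1 : (e x).1 = x.1 := rfl
  have e2 : (e x).2 = x.2 + M * x.1 + n₂ := rfl
  rw [sectorTerm, sectorTerm, e1, e2, ← mul_assoc, ← ex_add]
  congr 1
  · refine ex_eq_of_sub_int (k * x.1 * n₁) ?_
    push_cast
    rw [hj, hj']
    field_simp
    ring
  · rw [Complex.add_im, Complex.one_im, add_zero]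
    congr 1
    push_cast
    rw [hj]
    ring

/-! ### Transformation under `S` -/

/-- |Z|²/Im τ is invariant because Im(-1/τ) = Im τ/|τ|²; only 1/Z contributes. -/
theorem gaussKernel_S {k M : ℕ} {τ : ℂ} (hτ : 0 < τ.im) (Z : ℂ) :
    gaussKernel (k / (M * (-1 / τ).im)) (Z / τ) = τ * gaussKernel (k / (M * τ.im)) Z := by
  have h0 : τ ≠ 0 := by rintro rfl; simp at hτ
  have hn : ‖τ‖ ≠ 0 := norm_ne_zero_iff.2 h0
  have him : (-1 / τ).im = τ.im / ‖τ‖ ^ 2 := by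
    rw [neg_div, one_div, Complex.neg_im, Complex.inv_im, Complex.normSq_eq_norm_sq, neg_div, neg_neg]
  rw [gaussKernel, gaussKernel, him, norm_div]
  have e : Real.pi * (k / (M * (τ.im / ‖τ‖ ^ 2))) * (‖Z‖ / ‖τ‖) ^ 2 =
      Real.pi * (k / (M * τ.im)) * ‖Z‖ ^ 2 := by field_simp
  rw [e, div_div_eq_mul_div]
  ring

/-- Orthogonality of the characters of ℤ/M. Coprimality makes multiplication by k injective modulo
M, so the geometric ratio is 1 only when M divides N. -/
theorem sum_ex_range {k M : ℕ} (hM : 0 < M) (hkM : Nat.Coprime M k) (N : ℤ) :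
    ∑ b ∈ Finset.range M, ex (-(k * b * N / M)) = if (M : ℤ) ∣ N then (M : ℂ) else 0 := by
  have hMc : (M : ℂ) ≠ 0 := by exact_mod_cast hM.ne'
  have hpow : ∀ b : ℕ, ex (-(k * b * N / M)) = ex (-(k * N / M)) ^ b := fun b => by
    rw [← zpow_natCast, ← ex_int_mul]; congr 1; push_cast; ring
  simp only [hpow]
  split_ifs with h
  · obtain ⟨c, rfl⟩ := h
    have : ex (-(k * ((M * c : ℤ) : ℂ) / M)) = 1 :=
      (ex_eq_one_iff _).2 ⟨-(k * c), by push_cast; field_simp⟩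
    simp only [this, one_pow]
    simp
  · have hne : ex (-(k * N / M)) ≠ 1 := by
      rw [Ne, ex_eq_one_iff]
      rintro ⟨c, hc⟩
      apply h
      have h1 : (k : ℤ) * N = M * (-c) := by
        have : (k : ℂ) * N = M * (-c) := by
          field_simp at hc; linear_combination -hc
        exact_mod_cast this
      have h2 : (M : ℤ) ∣ k * N := ⟨-c, h1⟩
      exact IsCoprime.dvd_of_dvd_mul_left (Nat.isCoprime_iff_coprime.2 hkM) h2
    have hg := geom_sum_mul (ex (-(k * N / M))) M
    have h1 : ex (-(k * M * N / M)) = 1 := (ex_eq_one_iff _).2 ⟨-(k * N), by push_cast; field_simp⟩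
    rw [← hpow, h1, sub_self] at hg
    exact (mul_eq_zero.1 hg).resolve_right (sub_ne_zero.2 hne)

theorem tsum_prod_eq_sum_range {N : ℕ} (hN : 0 < N) {g : ℤ × ℤ → ℂ} (hg : Summable g) :
    ∑ j ∈ Finset.range N, ∑' x : ℤ × ℤ, g (j + N * x.1, x.2) = ∑' x : ℤ × ℤ, g x := by
  have hN0 : (N : ℤ) ≠ 0 := by exact_mod_cast hN.ne'
  rw [hg.tsum_prod, ← tsum_int_eq_sum_range hN hg.prod]
  refine Finset.sum_congr rfl fun j _ => ?_
  have hinj : Function.Injective fun x : ℤ × ℤ => ((j : ℤ) + N * x.1, x.2) := by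
    rintro ⟨a, b⟩ ⟨a', b'⟩ h
    simp only [Prod.mk.injEq] at h
    rw [mul_left_cancel₀ hN0 (add_left_cancel h.1), h.2]
  have hs : Summable fun x : ℤ × ℤ => g (j + N * x.1, x.2) := hg.comp_injective hinj
  exact hs.tsum_prod

theorem sum_indices (M : ℕ) (ε : ℚ) (f : ℚ → ℂ) :
    ∑ a ∈ indices M ε, f a = ∑ n ∈ Finset.range M, f (n + ε) := by
  rw [indices, Finset.sum_image]
  intro a _ b _ h
  exact_mod_cast add_right_cancel h

/-- The common summand of both sides of the transformation formula under `S`. -/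
noncomputable def dualTerm (k M : ℕ) (ε ε' j j' : ℚ) (τ z : ℂ) (p q : ℝ) (x : ℤ × ℤ) : ℂ :=
  ex ((k / M * ((x.1 + ε) * q - (x.2 + ε') * p - (x.1 + ε) * j' - ε * (j + x.2 + ε')) : ℝ)) *
    gaussKernel (k / (M * τ.im)) (z + (x.1 + ε) * τ + (x.2 + ε'))

theorem summable_dualTerm {k M : ℕ} (hk : 0 < k) (hM : 0 < M) (ε ε' j j' : ℚ) {τ : ℂ}
    (hτ : 0 < τ.im) (z : ℂ) (p q : ℝ) : Summable (dualTerm k M ε ε' j j' τ z p q) := by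
  have hk' : (0 : ℝ) < k := by exact_mod_cast hk
  have hM' : (0 : ℝ) < M := by exact_mod_cast hM
  refine Summable.of_norm ((summable_gaussKernel (a := k / (M * τ.im)) (by positivity) hτ
    (z + ε * τ + ε')).congr fun x => ?_)
  rw [dualTerm, norm_mul, norm_ex_ofReal, one_mul]
  congr 2
  ring

/-- After multiplication by τ, the points on the left are those of the full shifted lattice whose
second coordinate is -n modulo M. The character sum over b replaces this congruence, and the residue
of the first coordinate modulo M becomes a. -/
theorem sectorSum_S {k M : ℕ} (hk : 0 < k) (hM : 0 < M) (hkM : Nat.Coprime M k) {ε ε' j j' : ℚ}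
    (n n' : ℤ) (hj : j + ε' = n) (hj' : j' + ε' = n') {τ : ℂ} (hτ : 0 < τ.im) (z : ℂ) (p q : ℝ) :
    sectorSum k M ε j j' (-1 / τ) (z / τ) (-q) p =
      τ * (1 / M) * ∑ a ∈ indices M ε, ∑ b ∈ indices M ε,
        ex (-(k / M * (a * j' + b * j))) * sectorSum k M ε' a b τ z p q := by
  have hMc : (M : ℂ) ≠ 0 := by exact_mod_cast hM.ne'
  have h0 : τ ≠ 0 := by rintro rfl; simp at hτ
  have hjc : (j : ℂ) = n - ε' := by
    have : j = n - ε' := by rw [← hj]; ring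
    rw [this]; push_cast; rfl
  have hjc' : (j' : ℂ) = n' - ε' := by
    have : j' = n' - ε' := by rw [← hj']; ring
    rw [this]; push_cast; rfl
  set F := dualTerm k M ε ε' j j' τ z p q with hF
  have hFs : Summable F := summable_dualTerm hk hM ε ε' j j' hτ z p q
  -- The weight M on the congruence class is the value of the character sum; it accounts for the
  -- factor 1/M.
  let G : ℤ × ℤ → ℂ := fun x => (if (M : ℤ) ∣ n + x.2 then (M : ℂ) else 0) * F x
  have hGs : Summable G := by
    refine Summable.of_norm_bounded (hFs.norm.mul_left (M : ℝ)) fun x => ?_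
    simp only [G, norm_mul]
    gcongr
    split_ifs <;> simp
  have hleft : sectorSum k M ε j j' (-1 / τ) (z / τ) (-q) p = τ * (1 / M) * ∑' x, G x := by
    -- The lattice points of the left side, in the coordinates of the full lattice; its range
    -- contains the support of G.
    let i : ℤ × ℤ → ℤ × ℤ := fun x => (x.2, -n - M * x.1)
    have hi : Function.Injective i := by
      rintro ⟨a, b⟩ ⟨a', b'⟩ h
      simp only [i, Prod.mk.injEq] at h
      have hN0 : (M : ℤ) ≠ 0 := by exact_mod_cast hM.ne'
      rw [h.1, mul_left_cancel₀ hN0 (show (M : ℤ) * a = M * a' by linarith [h.2])]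
    have hsupp : Function.support G ⊆ Set.range i := by
      intro x hx
      have hd : (M : ℤ) ∣ n + x.2 := by
        by_contra hcon
        exact hx (by simp [G, hcon])
      obtain ⟨c, hc⟩ := hd
      refine ⟨(-c, x.1), Prod.ext rfl ?_⟩
      simp only [i]; linarith
    rw [← hi.tsum_eq hsupp, sectorSum, ← tsum_mul_left]
    refine tsum_congr fun x => ?_
    have hd : (M : ℤ) ∣ n + (-n - M * x.1) := ⟨-x.1, by ring⟩
    simp only [G, i, if_pos hd, hF, dualTerm, sectorTerm]
    have hz : z / τ + (j + M * x.1) * (-1 / τ) + (x.2 + ε) =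
        (z + (x.2 + ε) * τ + (((-n - M * x.1 : ℤ) : ℂ) + ε')) / τ := by
      push_cast; rw [hjc]; field_simp; ring
    rw [hz, gaussKernel_S hτ]
    have hex : ex ((k / M * ((j + M * x.1) * p - (x.2 + ε) * (-q + j') + M * x.1 * ε) : ℝ)) =
        ex ((k / M * ((x.2 + ε) * q - ((-n - M * x.1 : ℤ) + ε') * p - (x.2 + ε) * j'
          - ε * (j + (-n - M * x.1 : ℤ) + ε')) : ℝ)) := by
      congr 1
      push_cast
      rw [hjc]
      ring
    rw [hex]
    field_simp
  rw [hleft, ← tsum_prod_eq_sum_range hM hGs, sum_indices]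
  congr 1
  refine Finset.sum_congr rfl fun a _ => ?_
  rw [sum_indices]
  simp only [sectorSum, ← tsum_mul_left]
  rw [← Summable.tsum_finsetSum fun b _ => (summable_sectorTerm hk hM _ _ _ hτ _ _ _).mul_left _]
  refine tsum_congr fun x => ?_
  simp only [G]
  rw [← sum_ex_range hM hkM, Finset.sum_mul]
  refine Finset.sum_congr rfl fun b _ => ?_
  rw [hF, dualTerm, sectorTerm, ← mul_assoc, ← mul_assoc, ← ex_add, ← ex_add]
  congr 1
  -- Only here does integrality of j' + ε' enter: the phase in j' then depends on the first
  -- coordinate only modulo M.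
  · refine ex_eq_of_sub_int (-(k * x.1 * n')) ?_
    push_cast
    rw [hjc, hjc']
    field_simp
    ring
  · congr 1
    push_cast
    ring

theorem two_mul_sector {ε : ℚ} (h : ε ∈ sectors) : ∃ n : ℤ, 2 * ε = n := by
  rcases mem_sectors h with rfl | rfl
  · exact ⟨0, by simp⟩
  · exact ⟨1, by norm_num⟩

theorem index_eq {M : ℕ} {ε j : ℚ} (hε : ε ∈ sectors) (hj : j ∈ indices M ε) :
    ∃ n : ℤ, j = ε + n := ((mem_indices hε j).1 hj).1

theorem PsiMod_S {M : ℕ} (m : ℕ) (hM : 0 < M) (hkM : Nat.Coprime M (m + 1)) {ε ε' j j' : ℚ}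
    (hε : ε ∈ sectors) (hε' : ε' ∈ sectors) (hj : j ∈ indices M ε') (hj' : j' ∈ indices M ε')
    {τ z₁ z₂ : ℂ} (hτ : 0 < τ.im) (hreg : Regular ε' ε τ z₁ z₂) (t : ℂ) :
    PsiMod M m ε j j' (-1 / τ) (z₁ / τ) (z₂ / τ) (t - z₁ * z₂ / τ) =
      τ * (1 / M) * ∑ a ∈ indices M ε, ∑ b ∈ indices M ε,
        ex (-((m + 1) / M * (a * j' + b * j))) * PsiMod M m ε' a b τ z₁ z₂ t := by
  have h0 : τ ≠ 0 := by rintro rfl; simp at hτ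
  have hk : 0 < m + 1 := m.succ_pos
  have hτ' := neg_inv_im_pos hτ
  obtain ⟨e, he⟩ := two_mul_sector hε
  obtain ⟨e', he'⟩ := two_mul_sector hε'
  obtain ⟨n, hn⟩ := index_eq hε' hj
  obtain ⟨n', hn'⟩ := index_eq hε' hj'
  have hec : 2 * (ε : ℂ) = e := by exact_mod_cast he
  have hec' : 2 * (ε' : ℂ) = e' := by exact_mod_cast he'
  have hcoord : ∀ z : ℂ, coordP (-1 / τ) (z / τ) = -coordQ τ z ∧
      coordQ (-1 / τ) (z / τ) = coordP τ z := fun z => by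
    refine coord_unique hτ' ?_
    have := coord_eq hτ z
    push_cast
    field_simp
    linear_combination -this
  have hleft : ∀ (z : ℂ) (j : ℚ) (n : ℤ), j = ε' + n →
      (∀ a b : ℤ, z ≠ ε' + ε * τ + a + b * τ) →
      ∀ a b : ℤ, z / τ + j * (-1 / τ) + ε ≠ a + b * (-1 / τ) := by
    rintro z j n rfl h a b hab
    refine h (n - b) (a - e) ?_
    push_cast at hab ⊢
    rw [← hec]
    field_simp at hab
    linear_combination hab
  have hright : ∀ (z : ℂ) (a : ℚ), a ∈ indices M ε →
      (∀ a b : ℤ, z ≠ ε' + ε * τ + a + b * τ) →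
      ∀ c d : ℤ, z + a * τ + ε' ≠ c + d * τ := by
    intro z a ha h c d hcd
    obtain ⟨l, rfl⟩ := index_eq hε ha
    refine h (c - e') (d - l - e) ?_
    push_cast at hcd ⊢
    rw [← hec, ← hec']
    linear_combination hcd
  rw [PsiMod_eq m hM ε j j' hτ' (hleft z₁ j n hn fun a b => (hreg a b).1)
    (hleft z₂ j' n' hn' fun a b => (hreg a b).2.1)]
  rw [(hcoord z₁).1, (hcoord z₁).2, (hcoord z₂).1, (hcoord z₂).2]
  rw [sectorSum_S hk hM hkM (n + e') (n' + e') (by rw [hn]; push_cast; rw [← he']; ring)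
    (by rw [hn']; push_cast; rw [← he']; ring) hτ,
    sectorSum_S hk hM hkM (n' + e') (n + e') (by rw [hn']; push_cast; rw [← he']; ring)
    (by rw [hn]; push_cast; rw [← he']; ring) hτ]
  have ht : ∀ z w : ℂ, t - z₁ * z₂ / τ - z / τ * ((-coordQ τ w : ℝ) : ℂ) =
      t - z * coordP τ w + (z * w - z₁ * z₂) / τ := fun z w => by
    have := coord_eq hτ w
    push_cast
    field_simp
    linear_combination z * this
  rw [ht, ht, sub_self, mul_comm z₂ z₁, sub_self, zero_div, add_zero, add_zero]
  -- In the second half the roles of (j, z₁) and (j', z₂) are exchanged, so a and b must be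
  -- exchanged as well.
  rw [Finset.sum_comm (f := fun a b : ℚ => ex (-(((m + 1 : ℕ) : ℂ) / M * (a * j + b * j'))) *
    sectorSum (m + 1) M ε' a b τ z₂ (coordP τ z₁) (coordQ τ z₁))]
  simp only [Finset.mul_sum, ← Finset.sum_add_distrib]
  refine Finset.sum_congr rfl fun a ha => Finset.sum_congr rfl fun b hb => ?_
  rw [PsiMod_eq m hM ε' a b hτ (hright z₁ a ha fun a b => (hreg a b).1)
    (hright z₂ b hb fun a b => (hreg a b).2.1), add_comm ((b : ℂ) * j)]
  push_cast
  ring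

theorem PsiMod_T {M : ℕ} (m : ℕ) (hM : 0 < M) {ε ε'' j j' : ℚ} (n n' : ℤ) (hn : j + ε - ε'' = n)
    (hn' : j' + ε - ε'' = n') {τ z₁ z₂ : ℂ} (hτ : 0 < τ.im)
    (h₁ : ∀ a b : ℤ, z₁ + j * τ + ε'' ≠ a + b * τ) (h₂ : ∀ a b : ℤ, z₂ + j' * τ + ε'' ≠ a + b * τ)
    (t : ℂ) :
    PsiMod M m ε j j' (τ + 1) z₁ z₂ t =
      ex ((m + 1) * j * j' / M) * PsiMod M m ε'' j j' τ z₁ z₂ t := by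
  have hτ1 : 0 < (τ + 1).im := by simpa using hτ
  have hcoord : ∀ z : ℂ, coordP (τ + 1) z = coordP τ z ∧
      coordQ (τ + 1) z = coordQ τ z - coordP τ z := fun z => by
    refine coord_unique hτ1 ?_
    have := coord_eq hτ z
    push_cast
    linear_combination -this
  have hleft : ∀ (z : ℂ) (j : ℚ) (n : ℤ), j + ε - ε'' = n →
      (∀ a b : ℤ, z + j * τ + ε'' ≠ a + b * τ) →
      ∀ a b : ℤ, z + j * (τ + 1) + ε ≠ a + b * (τ + 1) := by
    intro z j n hn h a b hab
    have hnc : (j : ℂ) + ε - ε'' = n := by exact_mod_cast hn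
    refine h (a + b - n) b ?_
    push_cast
    rw [← hnc]
    linear_combination hab
  rw [PsiMod_eq m hM ε j j' hτ1 (hleft z₁ j n hn h₁) (hleft z₂ j' n' hn' h₂),
    PsiMod_eq m hM ε'' j j' hτ h₁ h₂, (hcoord z₁).1, (hcoord z₁).2, (hcoord z₂).1, (hcoord z₂).2,
    sectorSum_T hM n' n hn' hn, sectorSum_T hM n n' hn hn', mul_right_comm (((m + 1 : ℕ) : ℂ)) (j' : ℂ)]
  push_cast
  ring

/-! ### Transformation of the characters under `S` and `T` -/

theorem coprime_of_gcd {M m : ℕ} (hgcd : 0 < m → Nat.gcd M (2 * m + 2) = 1) :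
    Nat.Coprime M (m + 1) := by
  rcases Nat.eq_zero_or_pos m with rfl | hm
  · simp
  · have h : Nat.Coprime M (2 * m + 2) := hgcd hm
    exact h.coprime_dvd_right ⟨2, by ring⟩

theorem neg_one_cpow_sectors {ε ε' : ℚ} (hε : ε ∈ sectors) (hε' : ε' ∈ sectors) :
    (-1 : ℂ) ^ (4 * ε * ε' : ℂ) * ex (-2 * ε * ε') = 1 := by
  rcases mem_sectors hε with rfl | rfl <;> rcases mem_sectors hε' with rfl | rfl
  · simp [ex_zero]
  · simp [ex_zero]
  · simp [ex_zero]
  · have e1 : (4 * ((1 / 2 : ℚ) : ℂ) * ((1 / 2 : ℚ) : ℂ)) = 1 := by norm_num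
    have e2 : (-2 * ((1 / 2 : ℚ) : ℂ) * ((1 / 2 : ℚ) : ℂ)) = -(1 / 2) := by norm_num
    rw [e1, e2, ex_neg, ex_half, Complex.cpow_one]
    norm_num

/-- The weight factor τ cancels between numerator and denominator; the phase e^{-4πiεε'} of the
denominator becomes the sign. -/
theorem chMod_S {M m : ℕ} (hM : 0 < M) (hkM : Nat.Coprime M (m + 1)) {ε ε' j k : ℚ}
    (hε : ε ∈ sectors) (hε' : ε' ∈ sectors) (hj : j ∈ indices M ε') (hk : k ∈ indices M ε')
    {τ z₁ z₂ : ℂ} (t : ℂ) (hτ : 0 < τ.im) (hreg : Regular ε' ε τ z₁ z₂) :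
    chMod M m ε j k ε' (-1 / τ) (z₁ / τ) (z₂ / τ) (t - z₁ * z₂ / τ) =
      (-1 : ℂ) ^ (4 * ε * ε' : ℂ) * (1 / M) * ∑ a ∈ indices M ε, ∑ b ∈ indices M ε,
        Complex.exp (-(2 * Real.pi * Complex.I * (m + 1) / M) * (a * k + b * j)) *
          chMod M m ε' a b ε τ z₁ z₂ t := by
  have h0 : τ ≠ 0 := by rintro rfl; simp at hτ
  have he : ∀ a b : ℚ, Complex.exp (-(2 * Real.pi * Complex.I * (m + 1) / M) * (a * k + b * j)) =
      ex (-((m + 1) / M * (a * k + b * j))) := fun a b => by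
    rw [ex]; congr 1; ring
  simp only [he, chMod, ← mul_div_assoc, ← Finset.sum_div]
  rw [PsiMod_S m hM hkM hε hε' hj hk hτ hreg, Rhat_S hε' hτ]
  have hs := neg_one_cpow_sectors hε hε'
  have hex := ex_ne_zero (-2 * ε * ε')
  have hs' : (-1 : ℂ) ^ (4 * ε * ε' : ℂ) = (ex (-2 * ε * ε'))⁻¹ := eq_inv_of_mul_eq_one_left hs
  rw [hs', mul_assoc, mul_assoc τ, mul_div_mul_left _ _ h0, mul_comm (ex _) (Rhat _ _ _ _ _ _),
    ← div_div]
  ring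

theorem exists_int_abs_sub {ε ε' : ℚ} (hε : ε ∈ sectors) (hε' : ε' ∈ sectors) :
    ∃ n : ℤ, ε' + ε - |ε - ε'| = n := by
  rcases mem_sectors hε with rfl | rfl <;> rcases mem_sectors hε' with rfl | rfl
  · exact ⟨0, by simp⟩
  · exact ⟨0, by norm_num [abs_of_nonpos]⟩
  · exact ⟨0, by norm_num [abs_of_nonneg]⟩
  · exact ⟨1, by norm_num⟩

theorem abs_sub_mem_sectors {ε ε' : ℚ} (hε : ε ∈ sectors) (hε' : ε' ∈ sectors) :
    |ε - ε'| ∈ sectors := by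
  rcases mem_sectors hε with rfl | rfl <;> rcases mem_sectors hε' with rfl | rfl <;>
    norm_num [sectors, abs_of_nonpos, abs_of_nonneg]

theorem chMod_T {M m : ℕ} (hM : 0 < M) {ε ε' j k : ℚ}
    (hε : ε ∈ sectors) (hε' : ε' ∈ sectors) (hj : j ∈ indices M ε') (hk : k ∈ indices M ε')
    {τ z₁ z₂ : ℂ} (t : ℂ) (hτ : 0 < τ.im) (hreg : Regular |ε - ε'| ε' τ z₁ z₂) :
    chMod M m ε j k ε' (τ + 1) z₁ z₂ t =
      Complex.exp (2 * Real.pi * Complex.I * ((m + 1) * j * k / M) - Real.pi * Complex.I * ε') *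
        chMod M m |ε - ε'| j k ε' τ z₁ z₂ t := by
  obtain ⟨d, hd⟩ := exists_int_abs_sub hε hε'
  have hε'' := abs_sub_mem_sectors hε hε'
  set ε'' := |ε - ε'| with hdef
  obtain ⟨e, he⟩ := two_mul_sector hε''
  obtain ⟨e', he'⟩ := two_mul_sector hε'
  have hec : 2 * (ε'' : ℂ) = e := by exact_mod_cast he
  have hec' : 2 * (ε' : ℂ) = e' := by exact_mod_cast he'
  obtain ⟨n, hn⟩ := index_eq hε' hj
  obtain ⟨n', hn'⟩ := index_eq hε' hk
  have hleft : ∀ (z : ℂ) (j : ℚ) (n : ℤ), j = ε' + n →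
      (∀ a b : ℤ, z ≠ ε'' + ε' * τ + a + b * τ) →
      ∀ a b : ℤ, z + j * τ + ε'' ≠ a + b * τ := by
    rintro z j n rfl h a b hab
    refine h (a - e) (b - n - e') ?_
    push_cast at hab ⊢
    rw [← hec, ← hec']
    linear_combination hab
  rw [chMod, chMod, PsiMod_T m hM (n + d) (n' + d) (by rw [hn]; push_cast; rw [← hd]; ring)
    (by rw [hn']; push_cast; rw [← hd]; ring) hτ (hleft z₁ j n hn fun a b => (hreg a b).1)
    (hleft z₂ k n' hn' fun a b => (hreg a b).2.1), Rhat_T hε hε', ← hdef]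
  have hexp : Complex.exp (2 * Real.pi * Complex.I * ((m + 1) * j * k / M) - Real.pi * Complex.I * ε')
      = ex ((m + 1) * j * k / M) / ex (ε' / 2) := by
    rw [← ex_sub, ex]; congr 1; ring
  rw [hexp, mul_div_mul_comm]

/-! ### The span of the family under `SL₂(ℤ)` -/

/-- The singularities of the four sectors together fill the half-lattice. Unlike those of a single
sector, they are preserved by all of SL₂(ℤ), which makes compositions of S and T legitimate. -/
theorem forall_regular_iff (τ z₁ z₂ : ℂ) :
    (∀ σ ∈ sectors, ∀ σ' ∈ sectors, Regular σ σ' τ z₁ z₂) ↔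
      ∀ a b : ℤ, 2 * z₁ ≠ a + b * τ ∧ 2 * z₂ ≠ a + b * τ ∧ z₁ + z₂ ≠ a + b * τ := by
  have h0 : (0 : ℚ) ∈ sectors := by simp [sectors]
  have h1 : (1 / 2 : ℚ) ∈ sectors := by simp [sectors]
  constructor
  · intro h a b
    have key : ∀ z : ℂ, (∀ σ ∈ sectors, ∀ σ' ∈ sectors, ∀ a b : ℤ, z ≠ σ + σ' * τ + a + b * τ) →
        2 * z ≠ a + b * τ := by
      intro z hz hab
      rcases Int.even_or_odd' a with ⟨c, rfl | rfl⟩ <;> rcases Int.even_or_odd' b with ⟨d, rfl | rfl⟩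
      · refine hz 0 h0 0 h0 c d ?_
        push_cast at hab ⊢; linear_combination hab / 2
      · refine hz 0 h0 _ h1 c d ?_
        push_cast at hab ⊢; linear_combination hab / 2
      · refine hz _ h1 0 h0 c d ?_
        push_cast at hab ⊢; linear_combination hab / 2
      · refine hz _ h1 _ h1 c d ?_
        push_cast at hab ⊢; linear_combination hab / 2
    exact ⟨key z₁ fun σ hσ σ' hσ' a b => (h σ hσ σ' hσ' a b).1,
      key z₂ fun σ hσ σ' hσ' a b => (h σ hσ σ' hσ' a b).2.1, (h 0 h0 0 h0 a b).2.2⟩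
  · intro h σ hσ σ' hσ' a b
    obtain ⟨e, he⟩ := two_mul_sector hσ
    obtain ⟨e', he'⟩ := two_mul_sector hσ'
    have hec : 2 * (σ : ℂ) = e := by exact_mod_cast he
    have hec' : 2 * (σ' : ℂ) = e' := by exact_mod_cast he'
    have key : ∀ z : ℂ, 2 * z ≠ ((2 * a + e : ℤ) : ℂ) + ((2 * b + e' : ℤ) : ℂ) * τ →
        z ≠ σ + σ' * τ + a + b * τ := by
      intro z hz hab
      apply hz
      push_cast
      rw [← hec, ← hec']
      linear_combination 2 * hab
    exact ⟨key z₁ (h _ _).1, key z₂ (h _ _).2.1, (h a b).2.2⟩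

/-- The linear combination of the family with coefficients `c`. -/
noncomputable def familyComb (M m : ℕ) (c : ℚ → ℚ → ℚ → ℚ → ℂ) (τ z₁ z₂ t : ℂ) : ℂ :=
  ∑ σ ∈ sectors, ∑ σ' ∈ sectors, ∑ a ∈ indices M σ', ∑ b ∈ indices M σ',
    c σ σ' a b * chMod M m σ a b σ' τ z₁ z₂ t

/-- A function which is, off the singularities of the family, in its linear span. -/
def InFamilySpan (M m : ℕ) (f : ℂ → ℂ → ℂ → ℂ → ℂ) : Prop :=
  ∃ c : ℚ → ℚ → ℚ → ℚ → ℂ, ∀ τ z₁ z₂ t : ℂ, 0 < τ.im →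
    (∀ σ ∈ sectors, ∀ σ' ∈ sectors, Regular σ σ' τ z₁ z₂) →
      f τ z₁ z₂ t = familyComb M m c τ z₁ z₂ t

theorem inFamilySpan_sum {M m : ℕ} {ι : Type*} (s : Finset ι) (w : ι → ℂ)
    (f : ι → ℂ → ℂ → ℂ → ℂ → ℂ) (h : ∀ i ∈ s, InFamilySpan M m (f i)) :
    InFamilySpan M m fun τ z₁ z₂ t => ∑ i ∈ s, w i * f i τ z₁ z₂ t := by
  classical
  choose! c hc using h
  refine ⟨fun σ σ' a b => ∑ i ∈ s, w i * c i σ σ' a b, fun τ z₁ z₂ t hτ hr => ?_⟩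
  have h1 : ∑ i ∈ s, w i * f i τ z₁ z₂ t = ∑ i ∈ s, w i * familyComb M m (c i) τ z₁ z₂ t :=
    Finset.sum_congr rfl fun i hi => by rw [hc i hi τ z₁ z₂ t hτ hr]
  refine h1.trans ?_
  simp only [familyComb, Finset.mul_sum, Finset.sum_mul]
  rw [Finset.sum_comm]
  refine Finset.sum_congr rfl fun σ _ => ?_
  rw [Finset.sum_comm]
  refine Finset.sum_congr rfl fun σ' _ => ?_
  rw [Finset.sum_comm]
  refine Finset.sum_congr rfl fun a _ => ?_
  rw [Finset.sum_comm]
  refine Finset.sum_congr rfl fun b _ => Finset.sum_congr rfl fun i _ => ?_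
  ring

theorem inFamilySpan_chMod {M m : ℕ} {ε ε' j k : ℚ} (hε : ε ∈ sectors) (hε' : ε' ∈ sectors)
    (hj : j ∈ indices M ε') (hk : k ∈ indices M ε') :
    InFamilySpan M m (chMod M m ε j k ε') := by
  classical
  refine ⟨fun σ σ' a b => if σ = ε ∧ σ' = ε' ∧ a = j ∧ b = k then 1 else 0,
    fun τ z₁ z₂ t _ _ => ?_⟩
  rw [familyComb, Finset.sum_eq_single_of_mem ε hε, Finset.sum_eq_single_of_mem ε' hε',
    Finset.sum_eq_single_of_mem j hj, Finset.sum_eq_single_of_mem k hk]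
  · simp
  · intro b _ hb; simp [hb]
  · intro a _ ha; simp [ha]
  · intro σ' _ h; simp [h]
  · intro σ _ h; simp [h]

/-- The action of a matrix on functions of `(τ, z₁, z₂, t)`. -/
noncomputable def slash (γ : Matrix.SpecialLinearGroup (Fin 2) ℤ) (f : ℂ → ℂ → ℂ → ℂ → ℂ)
    (τ z₁ z₂ t : ℂ) : ℂ :=
  f ((γ 0 0 * τ + γ 0 1) / (γ 1 0 * τ + γ 1 1)) (z₁ / (γ 1 0 * τ + γ 1 1))
    (z₂ / (γ 1 0 * τ + γ 1 1)) (t - γ 1 0 * z₁ * z₂ / (γ 1 0 * τ + γ 1 1))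

theorem det_eq_one (γ : Matrix.SpecialLinearGroup (Fin 2) ℤ) :
    (γ 0 0 : ℂ) * γ 1 1 - γ 0 1 * γ 1 0 = 1 := by
  have := γ.det_coe
  rw [Matrix.det_fin_two] at this
  exact_mod_cast this

theorem denominator_ne_zero (γ : Matrix.SpecialLinearGroup (Fin 2) ℤ) {τ : ℂ} (hτ : 0 < τ.im) :
    (γ 1 0 * τ + γ 1 1 : ℂ) ≠ 0 := by
  intro h
  have him := congrArg Complex.im h
  have hc : (γ 1 0 : ℤ) = 0 := by
    simp at him
    rcases him with h | h
    · exact h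
    · exact absurd h hτ.ne'
  rw [hc] at h
  have hd : (γ 1 1 : ℂ) = 0 := by simpa using h
  have hdet := det_eq_one γ
  rw [hd, hc] at hdet
  simp at hdet

theorem smul_im_pos (γ : Matrix.SpecialLinearGroup (Fin 2) ℤ) {τ : ℂ} (hτ : 0 < τ.im) :
    0 < ((γ 0 0 * τ + γ 0 1) / (γ 1 0 * τ + γ 1 1) : ℂ).im := by
  have hD := denominator_ne_zero γ hτ
  have hdet : (γ 0 0 : ℝ) * γ 1 1 - γ 0 1 * γ 1 0 = 1 := by exact_mod_cast det_eq_one γ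
  have hn := Complex.normSq_pos.2 hD
  rw [Complex.div_im]
  have : (γ 0 0 * τ + γ 0 1 : ℂ).im * (γ 1 0 * τ + γ 1 1 : ℂ).re -
      (γ 0 0 * τ + γ 0 1 : ℂ).re * (γ 1 0 * τ + γ 1 1 : ℂ).im = τ.im := by
    simp
    linear_combination τ.im * hdet
  rw [← sub_div, this]
  positivity

theorem forall_regular_smul (γ : Matrix.SpecialLinearGroup (Fin 2) ℤ) {τ z₁ z₂ : ℂ} (hτ : 0 < τ.im)
    (h : ∀ σ ∈ sectors, ∀ σ' ∈ sectors, Regular σ σ' τ z₁ z₂) :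
    ∀ σ ∈ sectors, ∀ σ' ∈ sectors, Regular σ σ' ((γ 0 0 * τ + γ 0 1) / (γ 1 0 * τ + γ 1 1))
      (z₁ / (γ 1 0 * τ + γ 1 1)) (z₂ / (γ 1 0 * τ + γ 1 1)) := by
  have hD := denominator_ne_zero γ hτ
  rw [forall_regular_iff] at h ⊢
  intro a b
  have key : ∀ w : ℂ, w / (γ 1 0 * τ + γ 1 1) =
      a + b * ((γ 0 0 * τ + γ 0 1) / (γ 1 0 * τ + γ 1 1)) →
      w = ((a * γ 1 1 + b * γ 0 1 : ℤ) : ℂ) + ((a * γ 1 0 + b * γ 0 0 : ℤ) : ℂ) * τ := by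
    intro w hw
    field_simp at hw
    push_cast
    linear_combination hw
  obtain ⟨h1, h2, h3⟩ := h (a * γ 1 1 + b * γ 0 1) (a * γ 1 0 + b * γ 0 0)
  rw [← mul_div_assoc 2 z₁, ← mul_div_assoc 2 z₂, ← add_div]
  exact ⟨fun h => h1 (key _ h), fun h => h2 (key _ h), fun h => h3 (key _ h)⟩

/-- The cocycle rule for cτ + d. In the t-variable the two corrections add up to the one for γδ
because δ has determinant 1. -/
theorem slash_mul (γ δ : Matrix.SpecialLinearGroup (Fin 2) ℤ) (f : ℂ → ℂ → ℂ → ℂ → ℂ) {τ : ℂ}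
    (hτ : 0 < τ.im) (z₁ z₂ t : ℂ) :
    slash (γ * δ) f τ z₁ z₂ t = slash δ (slash γ f) τ z₁ z₂ t := by
  have hD := denominator_ne_zero δ hτ
  have hE := denominator_ne_zero γ (smul_im_pos δ hτ)
  have hF := denominator_ne_zero (γ * δ) hτ
  have e : ∀ i j : Fin 2, ((γ * δ : Matrix.SpecialLinearGroup (Fin 2) ℤ) i j : ℤ) =
      γ i 0 * δ 0 j + γ i 1 * δ 1 j := fun i j => by
    rw [Matrix.SpecialLinearGroup.coe_mul, Matrix.mul_apply, Fin.sum_univ_two]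
  have hdet := det_eq_one δ
  simp only [slash, e] at hF ⊢
  push_cast at hF ⊢
  have hDE : (γ 1 0 * ((δ 0 0 * τ + δ 0 1) / (δ 1 0 * τ + δ 1 1)) + γ 1 1 : ℂ) =
      ((γ 1 0 * δ 0 0 + γ 1 1 * δ 1 0) * τ + (γ 1 0 * δ 0 1 + γ 1 1 * δ 1 1)) /
        (δ 1 0 * τ + δ 1 1) := by
    rw [eq_div_iff hD, add_mul, mul_assoc, div_mul_cancel₀ _ hD]; ring
  rw [hDE]
  set D : ℂ := δ 1 0 * τ + δ 1 1 with hDdef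
  set F : ℂ := (γ 1 0 * δ 0 0 + γ 1 1 * δ 1 0) * τ + (γ 1 0 * δ 0 1 + γ 1 1 * δ 1 1) with hFdef
  congr 1
  · field_simp; rw [hDdef]; ring
  · field_simp
  · field_simp
  · field_simp
    rw [hFdef, hDdef]
    linear_combination -(γ 1 0 : ℂ) * z₁ * z₂ * hdet

/-- The matrices which map the family into its linear span. -/
def PreservesSpan (M m : ℕ) (γ : Matrix.SpecialLinearGroup (Fin 2) ℤ) : Prop :=
  ∀ ε ∈ sectors, ∀ ε' ∈ sectors, ∀ j ∈ indices M ε', ∀ k ∈ indices M ε',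
    InFamilySpan M m (slash γ (chMod M m ε j k ε'))

theorem preservesSpan_mul {M m : ℕ} {γ δ : Matrix.SpecialLinearGroup (Fin 2) ℤ}
    (hγ : PreservesSpan M m γ) (hδ : PreservesSpan M m δ) : PreservesSpan M m (γ * δ) := by
  intro ε hε ε' hε' j hj k hk
  obtain ⟨c, hc⟩ := hγ ε hε ε' hε' j hj k hk
  have h : InFamilySpan M m fun τ z₁ z₂ t => ∑ σ ∈ sectors, 1 * ∑ σ' ∈ sectors, 1 *
      ∑ a ∈ indices M σ', 1 * ∑ b ∈ indices M σ', c σ σ' a b *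
        slash δ (chMod M m σ a b σ') τ z₁ z₂ t :=
    inFamilySpan_sum _ _ _ fun σ hσ => inFamilySpan_sum _ _ _ fun σ' hσ' =>
      inFamilySpan_sum _ _ _ fun a ha => inFamilySpan_sum _ _ _ fun b hb =>
        hδ σ hσ σ' hσ' a ha b hb
  obtain ⟨c', hc'⟩ := h
  refine ⟨c', fun τ z₁ z₂ t hτ hr => ?_⟩
  rw [← hc' τ z₁ z₂ t hτ hr, slash_mul γ δ _ hτ]
  simp only [one_mul]
  exact hc _ _ _ _ (smul_im_pos δ hτ) (forall_regular_smul δ hτ hr)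

theorem preservesSpan_one (M m : ℕ) : PreservesSpan M m 1 := by
  intro ε hε ε' hε' j hj k hk
  obtain ⟨c, hc⟩ := inFamilySpan_chMod (m := m) hε hε' hj hk
  refine ⟨c, fun τ z₁ z₂ t hτ hr => ?_⟩
  rw [← hc τ z₁ z₂ t hτ hr]
  simp [slash]

theorem preservesSpan_S {M m : ℕ} (hM : 0 < M) (hkM : Nat.Coprime M (m + 1)) :
    PreservesSpan M m ModularGroup.S := by
  intro ε hε ε' hε' j hj k hk
  have h : InFamilySpan M m fun τ z₁ z₂ t => ∑ a ∈ indices M ε, 1 * ∑ b ∈ indices M ε,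
      ((-1 : ℂ) ^ (4 * ε * ε' : ℂ) * (1 / M) *
        Complex.exp (-(2 * Real.pi * Complex.I * (m + 1) / M) * (a * k + b * j))) *
          chMod M m ε' a b ε τ z₁ z₂ t :=
    inFamilySpan_sum _ _ _ fun a ha => inFamilySpan_sum _ _ _ fun b hb =>
      inFamilySpan_chMod hε' hε ha hb
  obtain ⟨c, hc⟩ := h
  refine ⟨c, fun τ z₁ z₂ t hτ hr => ?_⟩
  rw [← hc τ z₁ z₂ t hτ hr]
  have := chMod_S (m := m) hM hkM hε hε' hj hk t hτ (hr ε' hε' ε hε)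
  simp only [one_mul, mul_assoc _ (Complex.exp _), ← Finset.mul_sum]
  rw [← this]
  simp [slash, ModularGroup.S]

theorem preservesSpan_T {M m : ℕ} (hM : 0 < M) : PreservesSpan M m ModularGroup.T := by
  intro ε hε ε' hε' j hj k hk
  have hε'' := abs_sub_mem_sectors hε hε'
  have h := inFamilySpan_sum {()} (fun _ => Complex.exp (2 * Real.pi * Complex.I *
      ((m + 1) * j * k / M) - Real.pi * Complex.I * ε')) (fun _ => chMod M m |ε - ε'| j k ε')
      fun _ _ => inFamilySpan_chMod hε'' hε' hj hk
  obtain ⟨c, hc⟩ := h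
  refine ⟨c, fun τ z₁ z₂ t hτ hr => ?_⟩
  rw [← hc τ z₁ z₂ t hτ hr]
  simp only [Finset.sum_singleton]
  rw [← chMod_T hM hε hε' hj hk t hτ (hr _ hε'' ε' hε')]
  simp [slash, ModularGroup.T]

theorem preservesSpan {M m : ℕ} (hM : 0 < M) (hkM : Nat.Coprime M (m + 1))
    (γ : Matrix.SpecialLinearGroup (Fin 2) ℤ) : PreservesSpan M m γ := by
  have hS := preservesSpan_S hM hkM
  have hT := preservesSpan_T (m := m) hM
  have hSinv : PreservesSpan M m ModularGroup.S⁻¹ := by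
    -- Closure is known only for products, so inverses of the generators are written as positive
    -- words: S⁴ = 1 here, and (ST)³ = S² for T⁻¹ below.
    have : ModularGroup.S⁻¹ = ModularGroup.S * ModularGroup.S * ModularGroup.S := by decide
    rw [this]
    exact preservesSpan_mul (preservesSpan_mul hS hS) hS
  have hTinv : PreservesSpan M m ModularGroup.T⁻¹ := by
    have : ModularGroup.T⁻¹ = ModularGroup.S * ModularGroup.S * ModularGroup.S * ModularGroup.T *
        ModularGroup.S * ModularGroup.T * ModularGroup.S := by decide
    rw [this]
    exact preservesSpan_mul (preservesSpan_mul (preservesSpan_mul (preservesSpan_mul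
      (preservesSpan_mul (preservesSpan_mul hS hS) hS) hT) hS) hT) hS
  have hmem : γ ∈ Subgroup.closure {ModularGroup.S, ModularGroup.T} := by
    rw [SpecialLinearGroup.SL2Z_generators]; exact Subgroup.mem_top γ
  -- The statement is paired with its inverse so that the induction over the generated subgroup
  -- passes through inversion.
  suffices h : PreservesSpan M m γ ∧ PreservesSpan M m γ⁻¹ from h.1
  induction hmem using Subgroup.closure_induction with
  | mem x hx =>
    rcases hx with rfl | rfl
    · exact ⟨hS, hSinv⟩
    · exact ⟨hT, hTinv⟩
  | one => rw [inv_one]; exact ⟨preservesSpan_one M m, preservesSpan_one M m⟩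
  | mul x y _ _ hx hy =>
    rw [mul_inv_rev]
    exact ⟨preservesSpan_mul hx.1 hy.1, preservesSpan_mul hy.2 hx.2⟩
  | inv x _ hx => rw [inv_inv]; exact ⟨hx.2, hx.1⟩

end AdmissibleSl21

theorem theorem7p3 (M m : ℕ) (hM : 0 < M) (hgcd : 0 < m → Nat.gcd M (2 * m + 2) = 1) :
    -- the transformation under `S`
    (∀ ε ∈ AdmissibleSl21.sectors, ∀ ε' ∈ AdmissibleSl21.sectors,
      ∀ j ∈ AdmissibleSl21.indices M ε', ∀ k ∈ AdmissibleSl21.indices M ε',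
      ∀ τ z₁ z₂ t : ℂ, 0 < τ.im → AdmissibleSl21.Regular ε' ε τ z₁ z₂ →
        AdmissibleSl21.chMod M m ε j k ε' (-1 / τ) (z₁ / τ) (z₂ / τ) (t - z₁ * z₂ / τ) =
          (-1 : ℂ) ^ (4 * ε * ε' : ℂ) * (1 / M) *
            ∑ a ∈ AdmissibleSl21.indices M ε, ∑ b ∈ AdmissibleSl21.indices M ε,
              Complex.exp (-(2 * Real.pi * Complex.I * (m + 1) / M) * (a * k + b * j)) *
                AdmissibleSl21.chMod M m ε' a b ε τ z₁ z₂ t) ∧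
    -- the transformation under `T`
    (∀ ε ∈ AdmissibleSl21.sectors, ∀ ε' ∈ AdmissibleSl21.sectors,
      ∀ j ∈ AdmissibleSl21.indices M ε', ∀ k ∈ AdmissibleSl21.indices M ε',
      ∀ τ z₁ z₂ t : ℂ, 0 < τ.im → AdmissibleSl21.Regular |ε - ε'| ε' τ z₁ z₂ →
        AdmissibleSl21.chMod M m ε j k ε' (τ + 1) z₁ z₂ t =
          Complex.exp (2 * Real.pi * Complex.I * ((m + 1) * j * k / M)
              - Real.pi * Complex.I * ε') *
            AdmissibleSl21.chMod M m |ε - ε'| j k ε' τ z₁ z₂ t) ∧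
    -- the linear span of the family is invariant under `SL₂(ℤ)`
    (∀ γ : Matrix.SpecialLinearGroup (Fin 2) ℤ,
      ∀ ε ∈ AdmissibleSl21.sectors, ∀ ε' ∈ AdmissibleSl21.sectors,
      ∀ j ∈ AdmissibleSl21.indices M ε', ∀ k ∈ AdmissibleSl21.indices M ε',
      ∃ c : ℚ → ℚ → ℚ → ℚ → ℂ, ∀ τ z₁ z₂ t : ℂ, 0 < τ.im →
        (∀ σ ∈ AdmissibleSl21.sectors, ∀ σ' ∈ AdmissibleSl21.sectors,
          AdmissibleSl21.Regular σ σ' τ z₁ z₂) →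
        AdmissibleSl21.chMod M m ε j k ε'
            ((γ 0 0 * τ + γ 0 1) / (γ 1 0 * τ + γ 1 1))
            (z₁ / (γ 1 0 * τ + γ 1 1)) (z₂ / (γ 1 0 * τ + γ 1 1))
            (t - γ 1 0 * z₁ * z₂ / (γ 1 0 * τ + γ 1 1)) =
          ∑ σ ∈ AdmissibleSl21.sectors, ∑ σ' ∈ AdmissibleSl21.sectors,
            ∑ a ∈ AdmissibleSl21.indices M σ', ∑ b ∈ AdmissibleSl21.indices M σ',
              c σ σ' a b * AdmissibleSl21.chMod M m σ a b σ' τ z₁ z₂ t) := by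
  have hkM := AdmissibleSl21.coprime_of_gcd hgcd
  refine ⟨fun ε hε ε' hε' j hj k hk τ z₁ z₂ t hτ hr =>
      AdmissibleSl21.chMod_S hM hkM hε hε' hj hk t hτ hr,
    fun ε hε ε' hε' j hj k hk τ z₁ z₂ t hτ hr =>
      AdmissibleSl21.chMod_T hM hε hε' hj hk t hτ hr,
    fun γ ε hε ε' hε' j hj k hk =>
      AdmissibleSl21.preservesSpan hM hkM γ ε hε ε' hε' j hj k hk⟩
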